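/- Let $X$ be a second countable compact (Hausdorff) totally disconnected Abelian group containing no elements of order $2$. For a compact subgroup $K$ of $X$ let $m_K$ denote the Haar probability measure of $K$, regarded as a distribution on $X$, and let $I(X)$ be the set of all shifts $m_K * E_x$ of such distributions, where $K$ runs through the compact subgroups of $X$, $x\in X$, and $E_x$ is the unit mass at $x$. Let $\mathrm{Aut}(X)$ be the group of topological automorphisms of $X$ and $I$ the identity automorphism. The following statements are equivalent. (a) For every $\alpha\in\mathrm{Aut}(X)$ with $\mathrm{Ker}(I+\alpha)=\{0\}$ and for all independent random variables $\xi_1,\xi_2$ with values in $X$ and distributions $\mu_1,\mu_2$: if the conditional distribution of $L_2=\xi_1+\alpha\xi_2$ given $L_1=\xi_1+\xi_2$ is symmetric (that is, for almost every value of $L_1$ it is invariant under $x\mapsto -x$), then $\mu_1\in I(X)$ and $\mu_2\in I(X)$. (b) $X$ is topologically isomorphic to a direct product $\prod_{p} X_p$ over the prime numbers $p>2$, with the product topology, where each $X_p$ is a finite (possibly trivial) Abelian $p$-group with the discrete topology. Moreover, if (b) holds, then for every $\alpha\in\mathrm{Aut}(X)$ with $\mathrm{Ker}(I+\alpha)=\{0\}$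 and for all independent $X$-valued random variables $\xi_1,\xi_2$ with distributions $\mu_1,\mu_2$ such that the conditional distribution of $L_2$ given $L_1$ is symmetric, there is a compact subgroup $K$ of $X$ such that $\mu_1$ and $\mu_2$ are both shifts of $m_K$, and $\alpha(K)=K$. -/

import Mathlib

open MeasureTheory ProbabilityTheory TopologicalSpace

universe u v

/-- A compact Hausdorff second countable space with its Borel sets is a standard Borel space, so
that regular conditional distributions exist on it. -/
instance standardBorelSpace_of_compact (X : Type*) [TopologicalSpace X] [CompactSpace X]
    [T2Space X] [SecondCountableTopology X] [MeasurableSpace X] [BorelSpace X] :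
    StandardBorelSpace X := by
  let _ := metrizableSpaceMetric X
  infer_instance

/-- The conditional distribution of `η` given `ξ` is symmetric: for almost every value `t` of `ξ`,
the conditional law of `η` given `ξ = t` is invariant under `x ↦ -x`. -/
def CondDistribSymmetric {Ω X : Type*} [MeasurableSpace Ω] [MeasurableSpace X]
    [AddCommGroup X] [StandardBorelSpace X] (η ξ : Ω → X) (P : Measure Ω)
    [IsFiniteMeasure P] : Prop :=
  ∀ᵐ t ∂(P.map ξ), (condDistrib η ξ P t).map (fun x => -x) = condDistrib η ξ P t

section Haar

variable {X : Type*} [AddCommGroup X] [TopologicalSpace X] [IsTopologicalAddGroup X]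
  [MeasurableSpace X] [BorelSpace X]

/-- The Haar distribution `m_K` of a compact subgroup `K`: the Haar measure of `K` with total
mass one, regarded as a measure on the ambient group. -/
noncomputable def haarDistribution (K : AddSubgroup X) [CompactSpace K] : Measure X :=
  (Measure.addHaarMeasure (⊤ : PositiveCompacts K)).map ((↑) : K → X)

/-- `μ` is a shift of the Haar distribution of the compact subgroup `K`. -/
def IsShiftOfHaar (K : AddSubgroup X) [CompactSpace K] (μ : Measure X) : Prop :=
  ∃ x : X, μ = (haarDistribution K).map (fun y => y + x)

/-- `I(X)`: the shifts of Haar distributions of compact subgroups of `X`. -/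
def haarShifts (X : Type*) [AddCommGroup X] [TopologicalSpace X] [IsTopologicalAddGroup X]
    [MeasurableSpace X] [BorelSpace X] : Set (Measure X) :=
  {μ | ∃ (K : AddSubgroup X) (_ : CompactSpace K), IsShiftOfHaar K μ}

end Haar

/-- `X` is topologically isomorphic to a product, over the primes `p > 2`, of finite (discrete)
abelian `p`-groups, with the product topology. Some of the factors may be trivial. -/
def IsProductOfFiniteOddPGroups (X : Type*) [AddCommGroup X] [TopologicalSpace X] : Prop :=
  ∃ (A : {p : ℕ // p.Prime ∧ 2 < p} → Type) (_ : ∀ p, AddCommGroup (A p))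
    (_ : ∀ p, TopologicalSpace (A p)),
    (∀ p, DiscreteTopology (A p)) ∧ (∀ p, Finite (A p)) ∧
    (∀ p, ∀ x : A p, ∃ k : ℕ, addOrderOf x = (p : ℕ) ^ k) ∧
    Nonempty (X ≃ₜ+ (∀ p, A p))

/-- The condition `Ker (I + α) = {0}`. -/
def KerOneAddTrivial {X : Type*} [AddCommGroup X] [TopologicalSpace X] (α : X ≃ₜ+ X) : Prop :=
  (AddMonoidHom.id X + α.toAddEquiv.toAddMonoidHom).ker = ⊥

/-! Everything is moved to the character group `Y` of `X`, a countable torsion group. With `ε` the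
adjoint of `α` and `f`, `g` the Fourier transforms of `μ₁`, `μ₂`, symmetry of the conditional law
becomes `f (u + v) * g (u + ε v) = f (u - v) * g (u - ε v)`
(`condDistribSymmetric_iff_fourierTransform`).

If (b) holds, each `m`-torsion subgroup of `Y` is finite and `ε`-invariant, has no 2-torsion, and
`ε` and `1 + ε` are injective on it. There (`finite_functional_equation`) suitable substitutions
show that `|f|` and `|g|` cannot increase along the Cayley transform `κ = (1 - ε)(1 + ε)⁻¹`. On a
finite group this forces equality, and then both moduli take only the values 0 and 1, with the same
support, invariant under `ε`. The annihilator of that support is the required `K`.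

Conversely, suppose `Y` has a direct summand `D` with a surjective locally nilpotent endomorphism
`ν` and a suitable `χ ≠ 0` in `D` (`NilpotentSummand`). The automorphism `ν - 1` on `D`, extended by
the identity, dualises to an `α` with `Ker (I + α) = 0`, and the density `1 + Re χ / 2`, transported
by the adjoint of the projection, violates (a) (`exists_counterexample`). So (a) excludes such
summands. A nonzero divisible `p`-primary subgroup gives one with `ν = p²`; an infinite sequence of
biorthogonal cyclic `p`-summands, for odd `p`, gives one with `ν` the backward shift. A study of
heights shows that an infinite `p`-primary component with `p` odd contains one or the other, while
the 2-primary component is divisible because `X` has no element of order two. Hence the odd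
components are finite, the 2-component vanishes, and duality yields (b). -/

/-- A finitely generated subgroup of an abelian torsion group is finite. -/
lemma finite_closure_of_torsion {Y : Type*} [AddCommGroup Y]
    (hY : ∀ y : Y, ∃ m : ℕ, 0 < m ∧ m • y = 0) (s : Finset Y) :
    Finite (AddSubgroup.closure (s : Set Y)) := by
  have : AddGroup.FG (AddSubgroup.closure (s : Set Y)) := by
    rw [AddGroup.fg_iff_addSubgroup_fg]
    exact ⟨s, rfl⟩
  have : Module.Finite ℤ (AddSubgroup.closure (s : Set Y)) :=
    Module.Finite.iff_addGroup_fg.mpr this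
  refine Module.finite_of_fg_torsion _ ?_
  rintro ⟨y, hy⟩
  obtain ⟨m, hm, h⟩ := hY y
  refine ⟨⟨(m : ℤ), mem_nonZeroDivisors_of_ne_zero (by exact_mod_cast hm.ne')⟩, ?_⟩
  apply Subtype.ext
  change (m : ℤ) • y = 0
  rw [natCast_zsmul, h]

/-! ### Continuous characters -/

/-- The group of continuous characters of `X`, written additively. -/
def contChar (X : Type*) [AddCommGroup X] [TopologicalSpace X] : AddSubgroup (AddChar X Circle) where
  carrier := {y | Continuous y}
  zero_mem' := continuous_const
  add_mem' := fun {a b} (ha : Continuous a) (hb : Continuous b) => by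
    change Continuous fun x => a x * b x
    exact ha.mul hb
  neg_mem' := fun {a} (ha : Continuous a) => by
    change Continuous ⇑(-a)
    have : (⇑(-a) : X → Circle) = fun x => (a x)⁻¹ := funext fun x => AddChar.neg_apply' a x
    rw [this]
    exact ha.inv

namespace contChar

section Basic

variable {X : Type*} [AddCommGroup X] [TopologicalSpace X]

noncomputable instance : FunLike (contChar X) X Circle where
  coe y := y.1
  coe_injective _ _ h := Subtype.ext (DFunLike.coe_injective h)

@[ext] lemma ext {y z : contChar X} (h : ∀ x, y x = z x) : y = z := DFunLike.ext _ _ h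

lemma continuous_coe (y : contChar X) : Continuous y := y.2

@[simp] lemma zero_apply (x : X) : (0 : contChar X) x = 1 := rfl
@[simp] lemma add_apply (y z : contChar X) (x : X) : (y + z) x = y x * z x := rfl
@[simp] lemma neg_apply (y : contChar X) (x : X) : (-y) x = (y x)⁻¹ := AddChar.neg_apply' y.1 x
@[simp] lemma sub_apply (y z : contChar X) (x : X) : (y - z) x = y x / z x := by
  rw [sub_eq_add_neg, add_apply, neg_apply, div_eq_mul_inv]
@[simp] lemma nsmul_apply (n : ℕ) (y : contChar X) (x : X) : (n • y) x = y x ^ n := rfl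
@[simp] lemma map_zero (y : contChar X) : y 0 = 1 := AddChar.map_zero_eq_one y.1
@[simp] lemma map_add (y : contChar X) (a b : X) : y (a + b) = y a * y b :=
  AddChar.map_add_eq_mul y.1 a b
@[simp] lemma map_neg (y : contChar X) (a : X) : y (-a) = (y a)⁻¹ := AddChar.map_neg_eq_inv y.1 a
@[simp] lemma map_sub (y : contChar X) (a b : X) : y (a - b) = y a / y b :=
  AddChar.map_sub_eq_div y.1 a b
@[simp] lemma map_nsmul (y : contChar X) (n : ℕ) (a : X) : y (n • a) = y a ^ n :=
  AddChar.map_nsmul_eq_pow y.1 n a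

/-- The pullback of characters along a continuous homomorphism. -/
noncomputable def comap {Z : Type*} [AddCommGroup Z] [TopologicalSpace Z] (φ : X →+ Z)
    (hφ : Continuous φ) : contChar Z →+ contChar X where
  toFun y := ⟨y.1.compAddMonoidHom φ, y.2.comp hφ⟩
  map_zero' := rfl
  map_add' _ _ := rfl

@[simp] lemma comap_apply {Z : Type*} [AddCommGroup Z] [TopologicalSpace Z] (φ : X →+ Z)
    (hφ : Continuous φ) (y : contChar Z) (x : X) : comap φ hφ y x = y (φ x) := rfl

/-- The character group of a finite group is finite. -/
instance finite_addChar_circle (G : Type*) [AddCommGroup G] [Finite G] :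
    Finite (AddChar G Circle) :=
  Finite.of_equiv _ (AddChar.circleEquivComplex (α := G)).symm.toEquiv

lemma natCard_addChar_circle (G : Type*) [AddCommGroup G] [Finite G] :
    Nat.card (AddChar G Circle) = Nat.card G := by
  have := Fintype.ofFinite G
  rw [Nat.card_congr (AddChar.circleEquivComplex (α := G)).toEquiv, Nat.card_eq_fintype_card,
    Nat.card_eq_fintype_card, AddChar.card_eq]

lemma finite_setOf_trivial_on (V : AddSubgroup X) [Finite (X ⧸ V)] :
    {y : contChar X | ∀ x ∈ V, y x = 1}.Finite := by
  have key : ∀ y : {y : contChar X | ∀ x ∈ V, y x = 1}, ∃ ψ : AddChar (X ⧸ V) Circle,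
      ∀ x : X, ψ (x : X ⧸ V) = y.1 x := by
    rintro ⟨y, hy⟩
    refine ⟨AddChar.toAddMonoidHomEquiv.symm (QuotientAddGroup.lift V y.1.toAddMonoidHom ?_), ?_⟩
    · intro x hx
      exact congrArg Additive.ofMul (hy x hx)
    · intro x
      rfl
  choose ψ hψ using key
  have : Function.Injective ψ := by
    intro y z h
    apply Subtype.ext
    ext x
    rw [← hψ, ← hψ, h]
  exact Finite.of_injective ψ this

lemma finite_quotient [IsTopologicalAddGroup X] [CompactSpace X] (V : OpenAddSubgroup X) :
    Finite (X ⧸ V.toAddSubgroup) :=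
  AddSubgroup.quotient_finite_of_isOpen _ V.isOpen

/-- Every character of a finite group of continuous characters is an evaluation. -/
lemma exists_eval_of_finite (F : AddSubgroup (contChar X)) [Finite F] (φ : AddChar F Circle) :
    ∃ x : X, ∀ y : F, φ y = y.1 x := by
  let ev : X →+ AddChar F Circle :=
    { toFun := fun x =>
        { toFun := fun y => y.1 x
          map_zero_eq_one' := rfl
          map_add_eq_mul' := fun _ _ => rfl }
      map_zero' := by ext y; simp
      map_add' := fun a b => DFunLike.ext _ _ fun y => map_add y.1 a b }
  let em : F → AddChar ev.range Circle := fun y =>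
    { toFun := fun r => r.1 y
      map_zero_eq_one' := rfl
      map_add_eq_mul' := fun _ _ => rfl }
  have hem : Function.Injective em := by
    intro y z h
    apply Subtype.ext
    ext x
    exact congrArg (fun w : Circle => (w : ℂ)) (DFunLike.congr_fun h ⟨ev x, x, rfl⟩)
  -- Surjectivity of `ev` by counting: `F` embeds in the dual of `ev.range`, which has the same
  -- cardinality as `ev.range`, and this in turn is a subgroup of the dual of `F`, of the same
  -- cardinality as `F`.
  have h1 : Nat.card F ≤ Nat.card ev.range := by
    rw [← natCard_addChar_circle ev.range]
    exact Nat.card_le_card_of_injective em hem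
  have h2 : ev.range = ⊤ := by
    apply AddSubgroup.eq_top_of_le_card
    rwa [natCard_addChar_circle F]
  obtain ⟨x, hx⟩ : φ ∈ ev.range := h2 ▸ AddSubgroup.mem_top φ
  exact ⟨x, fun y => by rw [← hx]; rfl⟩

end Basic

/-- The circle has no small subgroups. -/
lemma eq_one_of_re_pow_pos (z : Circle) (h : ∀ n : ℕ, 0 < ((z ^ n : Circle) : ℂ).re) : z = 1 := by
  have hsq : ∀ w : Circle, ((w ^ 2 : Circle) : ℂ).re = 2 * (w : ℂ).re ^ 2 - 1 := by
    intro w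
    have := Circle.normSq_coe w
    rw [Complex.normSq_apply] at this
    rw [Circle.coe_pow, pow_two, Complex.mul_re]
    nlinarith
  -- Squaring at least doubles the defect `1 - re` while the real part is positive, whereas
  -- positivity bounds the defect by 1.
  have hdouble : ∀ n : ℕ, 2 ^ n * (1 - (z : ℂ).re) ≤ 1 - ((z ^ 2 ^ n : Circle) : ℂ).re := by
    intro n
    induction n with
    | zero => simp
    | succ n ih =>
      have h1 := h (2 ^ n)
      have h2 := hsq (z ^ 2 ^ n)
      rw [← pow_mul, ← pow_succ] at h2
      have h3 : ((z ^ 2 ^ n : Circle) : ℂ).re ≤ 1 := 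
        (Complex.re_le_norm _).trans_eq (Circle.norm_coe _)
      rw [h2, pow_succ]
      nlinarith
  have hre : (z : ℂ).re = 1 := by
    have h3 : (z : ℂ).re ≤ 1 := (Complex.re_le_norm _).trans_eq (Circle.norm_coe _)
    by_contra hne
    have hpos : 0 < 1 - (z : ℂ).re := by
      rcases lt_or_eq_of_le h3 with h | h
      · linarith
      · exact absurd h hne
    obtain ⟨n, hn⟩ := pow_unbounded_of_one_lt (1 / (1 - (z : ℂ).re)) (one_lt_two : (1 : ℝ) < 2)
    rw [div_lt_iff₀ hpos] at hn
    have := hdouble n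
    have := h (2 ^ n)
    linarith
  apply Circle.ext
  have := Circle.normSq_coe z
  rw [Complex.normSq_apply, hre] at this
  apply Complex.ext
  · simpa using hre
  · have : (z : ℂ).im * (z : ℂ).im = 0 := by linarith
    simpa using this

section Profinite

variable {X : Type*} [AddCommGroup X] [TopologicalSpace X] [IsTopologicalAddGroup X]
  [CompactSpace X] [TotallyDisconnectedSpace X]

/-- Some open subgroup lies inside the set where `y` has positive real part; its image is a subgroup
of the circle in the right half-plane, hence trivial. -/
lemma exists_openAddSubgroup_trivial_on (y : contChar X) :
    ∃ V : OpenAddSubgroup X, ∀ x ∈ V, y x = 1 := by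
  have hU : IsOpen {x : X | 0 < ((y x : Circle) : ℂ).re} :=
    isOpen_lt continuous_const
      (Complex.continuous_re.comp (continuous_subtype_val.comp (continuous_coe y)))
  obtain ⟨V, hV⟩ := ProfiniteGrp.exist_openNormalAddSubgroup_sub_open_nhds_of_zero hU
    (by simp)
  refine ⟨V.toOpenAddSubgroup, fun x hx => eq_one_of_re_pow_pos _ fun n => ?_⟩
  have : n • x ∈ (V : Set X) := V.toOpenAddSubgroup.nsmul_mem hx n
  simpa using hV this

/-- The character group of a profinite group is a torsion group. -/
lemma exists_nsmul_eq_zero (y : contChar X) : ∃ m : ℕ, 0 < m ∧ m • y = 0 := by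
  obtain ⟨V, hV⟩ := exists_openAddSubgroup_trivial_on y
  have := finite_quotient V
  refine ⟨Nat.card (X ⧸ V.toAddSubgroup), Nat.card_pos, ?_⟩
  ext x
  have hx : Nat.card (X ⧸ V.toAddSubgroup) • x ∈ V.toAddSubgroup := by
    rw [← QuotientAddGroup.eq_zero_iff, QuotientAddGroup.mk_nsmul]
    exact card_nsmul_eq_zero'
  have := hV _ hx
  rw [map_nsmul] at this
  rw [nsmul_apply, this, zero_apply]

/-- The continuous characters of a profinite group separate points. -/
lemma exists_apply_ne_one [T1Space X] {x : X} (hx : x ≠ 0) : ∃ y : contChar X, y x ≠ 1 := by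
  obtain ⟨V, hV⟩ := ProfiniteGrp.exist_openNormalAddSubgroup_sub_open_nhds_of_zero
    (U := {x}ᶜ) isOpen_compl_singleton (by simpa using hx.symm)
  have := finite_quotient V.toOpenAddSubgroup
  have hne : (QuotientAddGroup.mk x : X ⧸ V.toAddSubgroup) ≠ 0 := by
    rw [Ne, QuotientAddGroup.eq_zero_iff]
    intro h
    exact hV h rfl
  obtain ⟨ψ, hψ⟩ := AddChar.exists_apply_ne_zero.mpr hne
  have hdisc : DiscreteTopology (X ⧸ V.toAddSubgroup) :=
    QuotientAddGroup.discreteTopology V.isOpen'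
  refine ⟨⟨(AddChar.circleEquivComplex.symm ψ).compAddMonoidHom
    (QuotientAddGroup.mk' V.toAddSubgroup), ?_⟩, ?_⟩
  · have h1 : Continuous ⇑(AddChar.circleEquivComplex.symm ψ) := continuous_of_discreteTopology
    exact h1.comp (continuous_quotient_mk' (X := X))
  · intro h
    apply hψ
    have h1 : AddChar.circleEquivComplex (AddChar.circleEquivComplex.symm ψ) = ψ := by simp
    rw [← h1]
    have h2 : (AddChar.circleEquivComplex.symm ψ)
      (QuotientAddGroup.mk' V.toAddSubgroup x) = 1 := h
    change ((AddChar.circleEquivComplex.symm ψ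
      (QuotientAddGroup.mk' V.toAddSubgroup x) : Circle) : ℂ) = 1
    rw [h2]; rfl

lemma eq_of_forall_apply_eq [T1Space X] {a b : X} (h : ∀ y : contChar X, y a = y b) : a = b := by
  by_contra hne
  obtain ⟨y, hy⟩ := exists_apply_ne_one (sub_ne_zero.mpr hne)
  apply hy
  rw [map_sub, h, div_self']

/-- Each character is trivial on an open subgroup; there are countably many clopen sets, and only
finitely many characters are trivial on a given open subgroup. -/
instance countable [T2Space X] [SecondCountableTopology X] : Countable (contChar X) := by
  have hC : Countable (Clopens X) := Clopens.countable_iff_secondCountable.mpr inferInstance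
  rw [← Set.countable_univ_iff]
  have hcover : (Set.univ : Set (contChar X)) ⊆
      ⋃ C : Clopens X, {y : contChar X | ∃ V : OpenAddSubgroup X, (V : Set X) = C ∧
        ∀ x ∈ V, y x = 1} := by
    intro y _
    obtain ⟨V, hV⟩ := exists_openAddSubgroup_trivial_on y
    exact Set.mem_iUnion.mpr ⟨⟨V, V.isClopen⟩, V, rfl, hV⟩
  refine Set.Countable.mono hcover (Set.countable_iUnion fun C => ?_)
  by_cases h : ∃ V : OpenAddSubgroup X, (V : Set X) = C
  · obtain ⟨V, hV⟩ := h
    have := finite_quotient V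
    refine ((finite_setOf_trivial_on V.toAddSubgroup).subset ?_).countable
    rintro y ⟨W, hW, hy⟩ x hx
    apply hy
    have : x ∈ (V : Set X) := hx
    rw [hV, ← hW] at this
    exact this
  · convert Set.countable_empty
    ext y
    simp only [Set.mem_ofPred_eq, Set.mem_empty_iff_false, iff_false]
    rintro ⟨V, hV, -⟩
    exact h ⟨V, hV⟩

/-- Pontryagin duality for profinite groups: every character of the character group is an
evaluation. -/
lemma exists_eval (φ : AddChar (contChar X) Circle) : ∃ x : X, ∀ y : contChar X, φ y = y x := by
  have hne : (⋂ y : contChar X, {x : X | φ y = y x}).Nonempty := by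
    -- By compactness only finitely many characters have to be matched at once, and these generate a
    -- finite group because the character group is torsion.
    apply CompactSpace.iInter_nonempty
    · intro y
      exact isClosed_eq continuous_const (continuous_coe y)
    · intro s
      have := finite_closure_of_torsion (exists_nsmul_eq_zero (X := X)) s
      obtain ⟨x, hx⟩ := exists_eval_of_finite (AddSubgroup.closure (s : Set (contChar X)))
        (φ.compAddMonoidHom (AddSubgroup.subtype _))
      refine ⟨x, Set.mem_iInter₂.mpr fun y hy => hx ⟨y, AddSubgroup.subset_closure hy⟩⟩
  obtain ⟨x, hx⟩ := hne
  exact ⟨x, fun y => Set.mem_iInter.mp hx y⟩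

lemma continuous_of_forall_comp {Z : Type*} [TopologicalSpace Z] [T2Space X] (h : Z → X)
    (hc : ∀ y : contChar X, Continuous fun z => y (h z)) : Continuous h := by
  let j : X → (contChar X → Circle) := fun x y => y x
  have hj : Continuous j := continuous_pi fun y => (continuous_coe y)
  have hji : Function.Injective j := fun a b hab => eq_of_forall_apply_eq fun y => congrFun hab y
  have hemb : Topology.IsClosedEmbedding j := hj.isClosedEmbedding hji
  rw [hemb.isInducing.continuous_iff]
  exact continuous_pi hc

/-- The adjoint of an endomorphism of the character group. -/
lemma exists_adjoint [T2Space X] (e : contChar X →+ contChar X) :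
    ∃ h : X →+ X, Continuous h ∧ ∀ (y : contChar X) (x : X), y (h x) = e y x := by
  have key : ∀ x : X, ∃ x' : X, ∀ y : contChar X, e y x = y x' := fun x =>
    exists_eval
      { toFun := fun y => e y x
        map_zero_eq_one' := by simp
        map_add_eq_mul' := by simp }
  choose h hh using key
  refine ⟨{ toFun := h, map_zero' := ?_, map_add' := ?_ }, ?_, fun y x => (hh x y).symm⟩
  · exact eq_of_forall_apply_eq fun y => by rw [← hh]; simp
  · intro a b
    exact eq_of_forall_apply_eq fun y => by rw [← hh, map_add, map_add, hh, hh]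
  · refine continuous_of_forall_comp _ fun y => ?_
    change Continuous fun z => y (h z)
    simp_rw [← hh]
    exact continuous_coe (e y)

end Profinite

end contChar

/-! ### Fourier transforms of measures -/

/-- The Fourier transform of a measure, as a function on the group of continuous characters. -/
noncomputable def fourierTransform {X : Type*} [AddCommGroup X] [TopologicalSpace X]
    [MeasurableSpace X] (μ : Measure X) (y : contChar X) : ℂ :=
  ∫ x, (y x : ℂ) ∂μ

namespace fourierTransform

section Basic

variable {X : Type*} [AddCommGroup X] [TopologicalSpace X] [MeasurableSpace X]

lemma measurable_char [BorelSpace X] (y : contChar X) : Measurable fun x => (y x : ℂ) :=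
  (continuous_subtype_val.comp (contChar.continuous_coe y)).measurable

lemma integrable_char [BorelSpace X] (μ : Measure X) [IsFiniteMeasure μ] (y : contChar X) :
    Integrable (fun x => (y x : ℂ)) μ :=
  Integrable.of_bound (measurable_char y).aestronglyMeasurable 1
    (Filter.Eventually.of_forall fun x => (Circle.norm_coe (y x)).le)

lemma map_apply [BorelSpace X] {Ω : Type*} [MeasurableSpace Ω] {P : Measure Ω} {ξ : Ω → X} (hξ : Measurable ξ)
    (y : contChar X) : fourierTransform (P.map ξ) y = ∫ ω, (y (ξ ω) : ℂ) ∂P :=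
  integral_map hξ.aemeasurable (measurable_char y).aestronglyMeasurable

lemma zero_apply (μ : Measure X) [IsProbabilityMeasure μ] : fourierTransform μ 0 = 1 := by
  simp [fourierTransform]

lemma norm_le_one (μ : Measure X) [IsProbabilityMeasure μ] (y : contChar X) :
    ‖fourierTransform μ y‖ ≤ 1 := by
  refine (norm_integral_le_integral_norm _).trans ?_
  simp [Circle.norm_coe]

lemma neg_apply (μ : Measure X) (y : contChar X) :
    fourierTransform μ (-y) = starRingEnd ℂ (fourierTransform μ y) := by
  rw [fourierTransform, fourierTransform, ← integral_conj]
  congr 1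
  ext x
  rw [contChar.neg_apply, Circle.coe_inv_eq_conj]

lemma norm_neg_apply (μ : Measure X) (y : contChar X) :
    ‖fourierTransform μ (-y)‖ = ‖fourierTransform μ y‖ := by
  rw [neg_apply, RCLike.norm_conj]

/-- If the Fourier transform has absolute value one at a character, the character is almost
everywhere constant. -/
lemma ae_eq_of_norm_eq_one [BorelSpace X] (μ : Measure X) [IsProbabilityMeasure μ] {y : contChar X}
    (h : ‖fourierTransform μ y‖ = 1) : ∀ᵐ x ∂μ, (y x : ℂ) = fourierTransform μ y := by
  set c := fourierTransform μ y with hc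
  have hcc : starRingEnd ℂ c * c = 1 := by
    rw [← Complex.normSq_eq_conj_mul_self, Complex.normSq_eq_norm_sq, h]; simp
  have hintg : Integrable (fun x => starRingEnd ℂ c * (y x : ℂ)) μ :=
    (integrable_char μ y).const_mul _
  have hle : ∀ x, (starRingEnd ℂ c * (y x : ℂ)).re ≤ 1 := fun x =>
    (Complex.re_le_norm _).trans (by simp [h, Circle.norm_coe])
  -- A nonnegative integrand with integral zero vanishes almost everywhere, and a number of modulus
  -- one with real part one is one.
  have h0 : ∫ x, (1 - (starRingEnd ℂ c * (y x : ℂ)).re) ∂μ = 0 := by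
    have hsub : ∫ x, (1 - (starRingEnd ℂ c * (y x : ℂ)).re) ∂μ =
        ∫ _, (1 : ℝ) ∂μ - ∫ x, (starRingEnd ℂ c * (y x : ℂ)).re ∂μ :=
      integral_sub (integrable_const _) hintg.re
    rw [hsub, integral_const]
    have : ∫ x, (starRingEnd ℂ c * (y x : ℂ)).re ∂μ = 1 := by
      rw [show (fun x => (starRingEnd ℂ c * (y x : ℂ)).re) =
        fun x => RCLike.re (starRingEnd ℂ c * (y x : ℂ)) from rfl, integral_re hintg,
        integral_const_mul]
      change (starRingEnd ℂ c * c).re = 1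
      rw [hcc]; rfl
    rw [this]; simp
  rw [integral_eq_zero_iff_of_nonneg (fun x => sub_nonneg.mpr (hle x))
    ((integrable_const _).sub hintg.re)] at h0
  filter_upwards [h0] with x hx
  have hre : (starRingEnd ℂ c * (y x : ℂ)).re = 1 := by
    have : 1 - (starRingEnd ℂ c * (y x : ℂ)).re = 0 := hx
    linarith
  have hone : starRingEnd ℂ c * (y x : ℂ) = 1 := by
    have hn : Complex.normSq (starRingEnd ℂ c * (y x : ℂ)) = 1 := by
      rw [Complex.normSq_eq_norm_sq]; simp [h, Circle.norm_coe]
    rw [Complex.normSq_apply, hre] at hn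
    apply Complex.ext
    · simpa using hre
    · have : (starRingEnd ℂ c * (y x : ℂ)).im * (starRingEnd ℂ c * (y x : ℂ)).im = 0 := by linarith
      simpa using this
  calc (y x : ℂ) = (starRingEnd ℂ c * c) * (y x : ℂ) := by rw [hcc, one_mul]
    _ = c * (starRingEnd ℂ c * (y x : ℂ)) := by ring
    _ = c := by rw [hone, mul_one]

/-- The character `h` is almost everywhere constant, so it leaves the integral as a factor of
modulus one. -/
lemma norm_add_of_norm_eq_one [BorelSpace X] (μ : Measure X) [IsProbabilityMeasure μ] {h : contChar X}
    (hh : ‖fourierTransform μ h‖ = 1) (w : contChar X) :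
    ‖fourierTransform μ (w + h)‖ = ‖fourierTransform μ w‖ := by
  have : fourierTransform μ (w + h) = fourierTransform μ w * fourierTransform μ h := by
    conv_lhs => rw [fourierTransform]
    conv_rhs => rw [fourierTransform, ← integral_mul_const]
    apply integral_congr_ae
    filter_upwards [ae_eq_of_norm_eq_one μ hh] with x hx
    rw [contChar.add_apply, Circle.coe_mul, hx]
  rw [this, norm_mul, hh, mul_one]

end Basic

section Uniqueness

open BoundedContinuousFunction

variable {X : Type*} [AddCommGroup X] [TopologicalSpace X] [IsTopologicalAddGroup X]
  [CompactSpace X] [SecondCountableTopology X] [TotallyDisconnectedSpace X]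
  [MeasurableSpace X] [BorelSpace X]

/-- A continuous character as a bounded continuous complex-valued function. -/
noncomputable def charBCF (X : Type*) [AddCommGroup X] [TopologicalSpace X] [CompactSpace X] :
    Multiplicative (contChar X) →* (X →ᵇ ℂ) where
  toFun y := mkOfCompact ⟨fun x => (y.toAdd x : ℂ),
    continuous_subtype_val.comp (contChar.continuous_coe y.toAdd)⟩
  map_one' := by ext; simp
  map_mul' _ _ := by ext; simp

lemma charBCF_apply {X : Type*} [AddCommGroup X] [TopologicalSpace X] [CompactSpace X]
    (y : contChar X) (x : X) : charBCF X (Multiplicative.ofAdd y) x = y x := rfl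

/-- A finite measure on a profinite group is determined by its Fourier transform. -/
theorem ext_measure {μ ν : Measure X} [IsFiniteMeasure μ] [IsFiniteMeasure ν]
    (h : ∀ y : contChar X, fourierTransform μ y = fourierTransform ν y) : μ = ν := by
  let _ := metrizableSpaceMetric X
  let A₀ : Subalgebra ℂ (X →ᵇ ℂ) := Algebra.adjoin ℂ (Set.range (charBCF X))
  -- Products of characters are characters, so the generated algebra is just their span, and
  -- equality of integrals extends to it by linearity.
  have hA₀ : ∀ g, g ∈ A₀ ↔ g ∈ Submodule.span ℂ (Set.range (charBCF X)) := by
    intro g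
    have := Algebra.adjoin_eq_span (R := ℂ) (Set.range (charBCF X))
    rw [← MonoidHom.coe_mrange, Submonoid.closure_eq] at this
    rw [← MonoidHom.coe_mrange, ← this]
    rfl
  have hstar : ∀ g ∈ A₀, star g ∈ A₀ := by
    intro g hg
    rw [hA₀] at hg ⊢
    induction hg using Submodule.span_induction with
    | mem g hg =>
      obtain ⟨y, rfl⟩ := hg
      refine Submodule.subset_span ⟨Multiplicative.ofAdd (-y.toAdd), ?_⟩
      ext x
      rw [charBCF_apply, contChar.neg_apply, Circle.coe_inv_eq_conj]
      rfl
    | zero => rw [star_zero]; exact zero_mem _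
    | add a b _ _ ha hb => rw [star_add]; exact add_mem ha hb
    | smul c a _ ha => rw [star_smul]; exact Submodule.smul_mem _ _ ha
  let A : StarSubalgebra ℂ (X →ᵇ ℂ) := { A₀ with star_mem' := fun {g} hg => hstar g hg }
  refine ext_of_forall_mem_subalgebra_integral_eq_of_polish (𝕜 := ℂ) (A := A) ?_ ?_
  · intro a b hab
    obtain ⟨y, hy⟩ : ∃ y : contChar X, y a ≠ y b := by
      by_contra! hcon
      exact hab (contChar.eq_of_forall_apply_eq hcon)
    refine ⟨_, ⟨_, ⟨charBCF X (Multiplicative.ofAdd y),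
      Algebra.subset_adjoin ⟨_, rfl⟩, rfl⟩, rfl⟩, ?_⟩
    intro hcon
    exact hy (Circle.ext hcon)
  · intro g hg
    have hg' : g ∈ Submodule.span ℂ (Set.range (charBCF X)) := (hA₀ g).mp hg
    induction hg' using Submodule.span_induction with
    | mem g hg' =>
      obtain ⟨y, rfl⟩ := hg'
      exact h y.toAdd
    | zero => simp
    | add a b ha hb iha ihb =>
      have e1 := iha ((hA₀ a).mpr ha)
      have e2 := ihb ((hA₀ b).mpr hb)
      simp only [BoundedContinuousFunction.coe_add, Pi.add_apply]
      rw [integral_add (a.integrable μ) (b.integrable μ),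
        integral_add (a.integrable ν) (b.integrable ν), e1, e2]
    | smul c a ha iha =>
      have e1 := iha ((hA₀ a).mpr ha)
      simp only [BoundedContinuousFunction.coe_smul, integral_smul]
      rw [e1]

end Uniqueness

end fourierTransform

/-! ### Conditional symmetry as an identity of joint laws -/

section Symmetric

/-- The conditional distribution of `η` given `ξ` is symmetric if and only if the random vectors
`(ξ, η)` and `(ξ, -η)` are identically distributed. -/
theorem condDistribSymmetric_iff {Ω X : Type*} [MeasurableSpace Ω] [MeasurableSpace X]
    [AddCommGroup X] [MeasurableNeg X] [StandardBorelSpace X] {η ξ : Ω → X} {P : Measure Ω}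
    [IsFiniteMeasure P] (hη : Measurable η) (hξ : Measurable ξ) :
    CondDistribSymmetric η ξ P ↔
      P.map (fun ω => (ξ ω, η ω)) = P.map (fun ω => (ξ ω, -η ω)) := by
  have hneg : Measurable fun x : X => -x := measurable_neg
  have h1 : P.map (fun ω => (ξ ω, -η ω)) =
      P.map ξ ⊗ₘ (Kernel.map (condDistrib η ξ P) fun x => -x) := by
    rw [Measure.compProd_map hneg, compProd_map_condDistrib hη.aemeasurable,
      Measure.map_map (by fun_prop) (by fun_prop)]
    rfl
  rw [h1, ← condDistrib_ae_eq_iff_measure_eq_compProd ξ hη.aemeasurable]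
  have h2 : ∀ t, Kernel.map (condDistrib η ξ P) (fun x => -x) t =
      (condDistrib η ξ P t).map fun x => -x := fun t => Kernel.map_apply _ hneg t
  constructor
  · intro h
    filter_upwards [h] with t ht
    rw [h2, ht]
  · intro h
    filter_upwards [h] with t ht
    rw [← h2, ← ht]

end Symmetric

/-! ### Fourier transforms of Haar distributions -/

section HaarFourier

variable {X : Type*} [AddCommGroup X] [TopologicalSpace X] [IsTopologicalAddGroup X]
  [MeasurableSpace X] [BorelSpace X]

instance isProbabilityMeasure_addHaarMeasure_top (G : Type*) [AddGroup G] [TopologicalSpace G]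
    [IsTopologicalAddGroup G] [CompactSpace G] [MeasurableSpace G] [BorelSpace G] :
    IsProbabilityMeasure (Measure.addHaarMeasure (⊤ : PositiveCompacts G)) :=
  ⟨Measure.addHaarMeasure_self⟩

instance isProbabilityMeasure_haarDistribution (K : AddSubgroup X) [CompactSpace K] :
    IsProbabilityMeasure (haarDistribution K) :=
  Measure.isProbabilityMeasure_map measurable_subtype_coe.aemeasurable

-- Translation by a point `k` with `y k ≠ 1` multiplies the integral by `y k`, while invariance
-- leaves it unchanged.
open Classical in
lemma fourierTransform_addHaarMeasure_top {X : Type*} [AddCommGroup X] [TopologicalSpace X]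
    [IsTopologicalAddGroup X] [CompactSpace X] [MeasurableSpace X] [BorelSpace X] (y : contChar X) :
    fourierTransform (Measure.addHaarMeasure (⊤ : PositiveCompacts X)) y =
      if y = 0 then 1 else 0 := by
  split_ifs with h
  · rw [h, fourierTransform.zero_apply]
  · obtain ⟨k, hk⟩ : ∃ k, y k ≠ 1 := by
      by_contra! hcon
      exact h (contChar.ext hcon)
    have hinv := integral_add_left_eq_self (μ := Measure.addHaarMeasure (⊤ : PositiveCompacts X))
      (fun x : X => (y x : ℂ)) k
    simp only [contChar.map_add, Circle.coe_mul, integral_const_mul] at hinv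
    have hne : (y k : ℂ) - 1 ≠ 0 := fun hcon => hk (Circle.ext (by
      rw [Circle.coe_one]; linear_combination hcon))
    have : ((y k : ℂ) - 1) * ∫ x : X, (y x : ℂ) ∂(Measure.addHaarMeasure ⊤) = 0 := by
      linear_combination hinv
    exact (mul_eq_zero.mp this).resolve_left hne

open Classical in
lemma fourierTransform_haarDistribution (K : AddSubgroup X) [CompactSpace K] (y : contChar X) :
    fourierTransform (haarDistribution K) y = if ∀ k ∈ K, y k = 1 then 1 else 0 := by
  have h := fourierTransform_addHaarMeasure_top
    (contChar.comap K.subtype continuous_subtype_val y)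
  rw [haarDistribution, fourierTransform.map_apply measurable_subtype_coe]
  refine h.trans (if_congr ?_ rfl rfl)
  rw [DFunLike.ext_iff]
  exact Subtype.forall

lemma fourierTransform_map_add_right (μ : Measure X) (x : X) (y : contChar X) :
    fourierTransform (μ.map fun z => z + x) y = fourierTransform μ y * y x := by
  rw [fourierTransform.map_apply (measurable_add_const x), fourierTransform,
    ← integral_mul_const]
  simp

lemma norm_fourierTransform_of_mem_haarShifts {μ : Measure X} (h : μ ∈ haarShifts X)
    (y : contChar X) : ‖fourierTransform μ y‖ = 0 ∨ ‖fourierTransform μ y‖ = 1 := by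
  classical
  obtain ⟨K, hK, x, rfl⟩ := h
  rw [fourierTransform_map_add_right, fourierTransform_haarDistribution, norm_mul,
    Circle.norm_coe]
  split_ifs <;> simp

end HaarFourier

/-- The annihilator in `X` of a set of continuous characters. -/
def charAnnihilator {X : Type*} [AddCommGroup X] [TopologicalSpace X] (H : Set (contChar X)) :
    AddSubgroup X where
  carrier := {x | ∀ y ∈ H, y x = 1}
  zero_mem' := fun y _ => contChar.map_zero y
  add_mem' := fun {a b} ha hb y hy => by rw [contChar.map_add, ha y hy, hb y hy, one_mul]
  neg_mem' := fun {a} ha y hy => by rw [contChar.map_neg, ha y hy, inv_one]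

lemma mem_charAnnihilator {X : Type*} [AddCommGroup X] [TopologicalSpace X]
    {H : Set (contChar X)} {x : X} : x ∈ charAnnihilator H ↔ ∀ y ∈ H, y x = 1 := Iff.rfl

lemma isClosed_charAnnihilator {X : Type*} [AddCommGroup X] [TopologicalSpace X]
    (H : Set (contChar X)) : IsClosed (charAnnihilator H : Set X) := by
  have : (charAnnihilator H : Set X) = ⋂ y ∈ H, {x | y x = 1} := by
    ext x
    simp [mem_charAnnihilator]
  rw [this]
  exact isClosed_biInter fun y _ => isClosed_eq (contChar.continuous_coe y) continuous_const

/-! ### Recognising shifts of Haar distributions, and the functional equation -/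

section Profinite

variable {X : Type*} [AddCommGroup X] [TopologicalSpace X] [IsTopologicalAddGroup X]
  [CompactSpace X] [T2Space X] [SecondCountableTopology X] [TotallyDisconnectedSpace X]
  [MeasurableSpace X] [BorelSpace X]

instance compactSpace_charAnnihilator (H : Set (contChar X)) : CompactSpace (charAnnihilator H) :=
  isCompact_iff_compactSpace.mp (isClosed_charAnnihilator H).isCompact

/-- A distribution whose Fourier transform has absolute value one on `H` and vanishes off `H` is a
shift of the Haar distribution of the annihilator of `H`. -/
theorem isShiftOfHaar_charAnnihilator (μ : Measure X) [IsProbabilityMeasure μ]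
    (H : Set (contChar X)) (h1 : ∀ y ∈ H, ‖fourierTransform μ y‖ = 1)
    (h0 : ∀ y ∉ H, fourierTransform μ y = 0) : IsShiftOfHaar (charAnnihilator H) μ := by
  classical
  -- Countability of the character group puts all these identities on one set of full measure; any
  -- of its points serves as the shift.
  have hae : ∀ᵐ x ∂μ, ∀ y : contChar X, y ∈ H → (y x : ℂ) = fourierTransform μ y := by
    rw [ae_all_iff]
    intro y
    by_cases hy : y ∈ H
    · filter_upwards [fourierTransform.ae_eq_of_norm_eq_one μ (h1 y hy)] with x hx _
      exact hx
    · exact Filter.Eventually.of_forall fun x h => absurd h hy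
  obtain ⟨x₀, hx₀⟩ := hae.exists
  refine ⟨x₀, ?_⟩
  have : IsProbabilityMeasure ((haarDistribution (charAnnihilator H)).map fun y => y + x₀) :=
    Measure.isProbabilityMeasure_map (measurable_add_const x₀).aemeasurable
  refine fourierTransform.ext_measure fun y => ?_
  rw [fourierTransform_map_add_right, fourierTransform_haarDistribution]
  split_ifs with hy
  · rw [one_mul, fourierTransform]
    have : (fun x => (y x : ℂ)) =ᵐ[μ] fun _ => (y x₀ : ℂ) := by
      filter_upwards [hae] with x hx
      -- Here `y` is only known to lie in the double annihilator of `H`. Applying `hy` to `x - x₀`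
      -- shows directly that `y` is almost everywhere constant, so `H` need not be shown to be a
      -- subgroup.
      have hmem : x - x₀ ∈ charAnnihilator H := by
        intro z hz
        rw [contChar.map_sub, div_eq_one]
        exact Circle.ext ((hx z hz).trans (hx₀ z hz).symm)
      have := hy _ hmem
      rw [contChar.map_sub, div_eq_one] at this
      rw [this]
    rw [integral_congr_ae this]
    simp
  · rw [zero_mul]
    apply h0
    intro hyH
    exact hy fun k hk => hk y hyH

/-- The equation on the character group that expresses the symmetry of the conditional
distribution of `ξ₁ + α ξ₂` given `ξ₁ + ξ₂`. -/
theorem condDistribSymmetric_iff_fourierTransform {Ω : Type*} [MeasurableSpace Ω]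
    {P : Measure Ω} [IsProbabilityMeasure P] {ξ₁ ξ₂ : Ω → X} (h₁ : Measurable ξ₁)
    (h₂ : Measurable ξ₂) (hind : IndepFun ξ₁ ξ₂ P) (α : X →+ X) (hα : Continuous α) :
    CondDistribSymmetric (fun ω => ξ₁ ω + α (ξ₂ ω)) (fun ω => ξ₁ ω + ξ₂ ω) P ↔
      ∀ u v : contChar X,
        fourierTransform (P.map ξ₁) (u + v) *
            fourierTransform (P.map ξ₂) (u + contChar.comap α hα v) =
          fourierTransform (P.map ξ₁) (u - v) *
            fourierTransform (P.map ξ₂) (u - contChar.comap α hα v) := by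
  have hαm : Measurable α := hα.measurable
  have hm1 : Measurable fun ω => (ξ₁ ω + ξ₂ ω, ξ₁ ω + α (ξ₂ ω)) :=
    (h₁.add h₂).prodMk (h₁.add (hαm.comp h₂))
  have hm2 : Measurable fun ω => (ξ₁ ω + ξ₂ ω, -(ξ₁ ω + α (ξ₂ ω))) :=
    (h₁.add h₂).prodMk (h₁.add (hαm.comp h₂)).neg
  have hprod : ∀ u v : contChar X, ∫ ω, (u (ξ₁ ω) : ℂ) * (v (ξ₂ ω) : ℂ) ∂P =
      fourierTransform (P.map ξ₁) u * fourierTransform (P.map ξ₂) v := by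
    intro u v
    rw [fourierTransform.map_apply h₁, fourierTransform.map_apply h₂]
    exact hind.integral_fun_comp_mul_comp h₁.aemeasurable h₂.aemeasurable
      (f := fun x => (u x : ℂ)) (g := fun x => (v x : ℂ))
      (fourierTransform.measurable_char u).aestronglyMeasurable
      (fourierTransform.measurable_char v).aestronglyMeasurable
  -- Regrouping `u (ξ₁ + ξ₂) * v (ξ₁ + α ξ₂)` by variable gives `u + v` at `ξ₁` and `u + ε v` at
  -- `ξ₂`, with `ε` the adjoint of `α`; independence then factors the expectation.
  have hft1 : ∀ Ψ : contChar (X × X), ∀ u v : contChar X, (∀ a b, Ψ (a, b) = u a * v b) →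
      fourierTransform (P.map fun ω => (ξ₁ ω + ξ₂ ω, ξ₁ ω + α (ξ₂ ω))) Ψ =
        fourierTransform (P.map ξ₁) (u + v) *
          fourierTransform (P.map ξ₂) (u + contChar.comap α hα v) := by
    intro Ψ u v hΨ
    rw [fourierTransform.map_apply hm1, ← hprod]
    congr 1
    ext ω
    rw [hΨ, ← Circle.coe_mul]
    congr 1
    simp only [contChar.map_add, contChar.add_apply, contChar.comap_apply]
    exact mul_mul_mul_comm _ _ _ _
  have hft2 : ∀ Ψ : contChar (X × X), ∀ u v : contChar X, (∀ a b, Ψ (a, b) = u a * v b) →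
      fourierTransform (P.map fun ω => (ξ₁ ω + ξ₂ ω, -(ξ₁ ω + α (ξ₂ ω)))) Ψ =
        fourierTransform (P.map ξ₁) (u - v) *
          fourierTransform (P.map ξ₂) (u - contChar.comap α hα v) := by
    intro Ψ u v hΨ
    rw [fourierTransform.map_apply hm2, ← hprod]
    congr 1
    ext ω
    rw [hΨ, ← Circle.coe_mul]
    congr 1
    simp only [contChar.map_add, contChar.map_neg, contChar.sub_apply, contChar.comap_apply,
      mul_inv, div_eq_mul_inv]
    exact mul_mul_mul_comm _ _ _ _
  refine (condDistribSymmetric_iff (η := fun ω => ξ₁ ω + α (ξ₂ ω)) (ξ := fun ω => ξ₁ ω + ξ₂ ω)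
    (h₁.add (hαm.comp h₂)) (h₁.add h₂)).trans ?_
  constructor
  · intro h u v
    let Ψ : contChar (X × X) :=
      contChar.comap (AddMonoidHom.fst X X) continuous_fst u +
        contChar.comap (AddMonoidHom.snd X X) continuous_snd v
    have hΨ : ∀ a b, Ψ (a, b) = u a * v b := fun a b => rfl
    rw [← hft1 Ψ u v hΨ, ← hft2 Ψ u v hΨ, h]
  · intro h
    have := Measure.isProbabilityMeasure_map (μ := P) hm1.aemeasurable
    have := Measure.isProbabilityMeasure_map (μ := P) hm2.aemeasurable
    refine fourierTransform.ext_measure fun Ψ => ?_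
    have hΨ : ∀ a b, Ψ (a, b) =
        contChar.comap (AddMonoidHom.inl X X) (continuous_id.prodMk continuous_const) Ψ a *
          contChar.comap (AddMonoidHom.inr X X) (continuous_const.prodMk continuous_id) Ψ b := by
      intro a b
      change Ψ (a, b) = Ψ (a, 0) * Ψ (0, b)
      rw [← contChar.map_add, Prod.mk_add_mk, add_zero, zero_add]
    rw [hft1 Ψ _ _ hΨ, hft2 Ψ _ _ hΨ, h]

end Profinite

/-! ### The functional equation on a finite group -/

section FiniteEquation

/-- By pigeonhole the powers are periodic from some exponent `i` on; any positive multiple of the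
period that is at least `i` works. -/
lemma exists_isIdempotentElem_pow {M : Type*} [Monoid M] [Finite M] (a : M) :
    ∃ n : ℕ, 0 < n ∧ a ^ n * a ^ n = a ^ n := by
  obtain ⟨i, j, hij, h⟩ := Finite.exists_ne_map_eq_of_infinite (fun n : ℕ => a ^ n)
  wlog hlt : i < j generalizing i j
  · exact this j i hij.symm h.symm (by omega)
  obtain ⟨p, rfl⟩ := Nat.exists_eq_add_of_lt hlt
  have hper : ∀ t m : ℕ, i ≤ m → a ^ (m + t * (p + 1)) = a ^ m := by
    intro t
    induction t with
    | zero => intro m _; simp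
    | succ t ih =>
      intro m hm
      obtain ⟨r, rfl⟩ := Nat.exists_eq_add_of_le hm
      rw [show i + r + (t + 1) * (p + 1) = (i + p + 1 + r) + t * (p + 1) by ring,
        ih _ (by omega), pow_add, ← show a ^ i = a ^ (i + p + 1) from h, ← pow_add]
  refine ⟨(i + 1) * (p + 1), by positivity, ?_⟩
  rw [← pow_add]
  exact hper (i + 1) _ (by nlinarith)

variable {F : Type*} [AddCommGroup F] [Finite F]

instance finite_addMonoidEnd : Finite (AddMonoid.End F) :=
  Finite.of_injective (fun T : AddMonoid.End F => (T : F → F)) DFunLike.coe_injective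

lemma exists_pow_succ_eq_one_of_injective (T : AddMonoid.End F) (hT : Function.Injective T) :
    ∃ k : ℕ, T ^ (k + 1) = 1 := by
  obtain ⟨n, hn, h⟩ := exists_isIdempotentElem_pow T
  obtain ⟨k, rfl⟩ := Nat.exists_eq_succ_of_ne_zero hn.ne'
  refine ⟨k, ?_⟩
  ext w
  have hinj : Function.Injective (T ^ (k + 1) : AddMonoid.End F) := by
    rw [AddMonoid.End.coe_pow]
    exact hT.iterate _
  apply hinj
  exact DFunLike.congr_fun h w

/-- A set mapped into itself by an injective endomorphism of a finite group is invariant. -/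
lemma apply_iff_of_injective {T : AddMonoid.End F} (hT : Function.Injective T) {p : F → Prop}
    (h : ∀ w, p w → p (T w)) (w : F) : p (T w) ↔ p w := by
  refine ⟨fun hw => ?_, h w⟩
  obtain ⟨k, hk⟩ := exists_pow_succ_eq_one_of_injective T hT
  have hpow : ∀ (n : ℕ) (z : F), p z → p ((T ^ n) z) := by
    intro n
    induction n with
    | zero => exact fun z hz => hz
    | succ n ih => exact fun z hz => by rw [pow_succ]; exact ih _ (h z hz)
  have := hpow k _ hw
  rwa [show (T ^ k) (T w) = (T ^ (k + 1)) w by rw [pow_succ]; rfl, hk] at this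

/-- The properties of the absolute value of a characteristic function that are used below. -/
structure IsCharNorm (a : F → ℝ) : Prop where
  map_zero : a 0 = 1
  nonneg : ∀ w, 0 ≤ a w
  le_one : ∀ w, a w ≤ 1
  map_neg : ∀ w, a (-w) = a w
  map_add : ∀ w h, a h = 1 → a (w + h) = a w

/-- Although `κ` may have a kernel, some power `e = κ ^ n` is idempotent. Since `e` kills `z - e z`,
monotonicity gives `1 = a 0 ≤ a (z - e z)`, so `a` is invariant under translation by `z - e z` and
`a (e z) = a z`. No decrease is then possible along the orbit. -/
lemma IsCharNorm.apply_eq_of_apply_le {a : F → ℝ} (ha : IsCharNorm a) (κ : AddMonoid.End F)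
    (h : ∀ w, a (κ w) ≤ a w) (w : F) : a (κ w) = a w := by
  obtain ⟨n, hn, he⟩ := exists_isIdempotentElem_pow κ
  have hpow : ∀ (m : ℕ) (z : F), a ((κ ^ m) z) ≤ a z := by
    intro m
    induction m with
    | zero => exact fun z => le_rfl
    | succ m ih => exact fun z => by rw [pow_succ]; exact (ih _).trans (h z)
  have hproj : ∀ z, a ((κ ^ n) z) = a z := by
    intro z
    have h0 : (κ ^ n) (z - (κ ^ n) z) = 0 := by
      rw [_root_.map_sub, show (κ ^ n) ((κ ^ n) z) = (κ ^ n * κ ^ n) z from rfl, he, sub_self]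
    have h1 : a (z - (κ ^ n) z) = 1 := by
      refine le_antisymm (ha.le_one _) ?_
      have := hpow n (z - (κ ^ n) z)
      rwa [h0, ha.map_zero] at this
    have := ha.map_add ((κ ^ n) z) _ h1
    rw [← this, add_sub_cancel]
  refine le_antisymm (h w) ?_
  obtain ⟨m, rfl⟩ := Nat.exists_eq_succ_of_ne_zero hn.ne'
  calc a w = a ((κ ^ (m + 1)) w) := (hproj w).symm
    _ = a ((κ ^ m) (κ w)) := by rw [pow_succ]; rfl
    _ ≤ a (κ w) := hpow m _

/-- On a finite group of odd order, the solutions of the functional equation have absolute values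
zero and one, and they are supported on a common invariant subgroup. -/
theorem finite_functional_equation {a c : F → ℝ} (ha : IsCharNorm a) (hc : IsCharNorm c)
    (ε : AddMonoid.End F) (hε : Function.Injective ε)
    (hA : Function.Injective (1 + ε : AddMonoid.End F)) (h2 : ∀ w : F, w + w = 0 → w = 0)
    (heq : ∀ u v, a (u + v) * c (u + ε v) = a (u - v) * c (u - ε v)) (w : F) :
    (a w = 0 ∨ a w = 1) ∧ (a w = 1 ↔ c w = 1) ∧ (c w = 0 ∨ c w = 1) ∧
      (a (ε w) = 1 ↔ a w = 1) := by
  obtain ⟨k, hk⟩ := exists_pow_succ_eq_one_of_injective _ hA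
  set A : AddMonoid.End F := 1 + ε with hAdef
  set A' : AddMonoid.End F := A ^ k with hA'def
  have hAA' : A * A' = 1 := by rw [hA'def, ← pow_succ', hk]
  have hcomm : A' * ε = ε * A' := by
    have : Commute ε A := (Commute.one_right ε).add_right (Commute.refl ε)
    exact (this.pow_right k).symm.eq
  have hA' : ∀ z, A' z + ε (A' z) = z := fun z => DFunLike.congr_fun hAA' z
  have hA'inj : Function.Injective A' := by
    intro z z' h
    rw [← hA' z, ← hA' z', h]
  -- With `A' = (1 + ε)⁻¹`, this is the Cayley transform of `ε`, and `M = 2 A' = 1 + κ`.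
  let κ : AddMonoid.End F := A' - ε * A'
  let M : AddMonoid.End F := A' + A'
  have hκ : ∀ z, κ z = A' z - ε (A' z) := fun z => rfl
  have hM : ∀ z, M z = A' z + A' z := fun z => rfl
  have hMκ : ∀ z, M z = z + κ z := by
    intro z
    rw [hM, hκ]
    nth_rewrite 3 [← hA' z]
    abel
  have hMinj : Function.Injective M := by
    rw [injective_iff_map_eq_zero]
    intro z hz
    exact (injective_iff_map_eq_zero A').mp hA'inj z (h2 _ hz)
  have hεMinj : Function.Injective (ε * M : AddMonoid.End F) := hε.comp hMinj
  -- The choice `u = v = A' z` turns the factor of `a` on the right into `a 0`; in `h3`, `u = ε (A'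
  -- z)` and `v = A' z` do the same for `c`.
  have h1 : ∀ z, c (κ z) = a (M z) * c z := by
    intro z
    have := heq (A' z) (A' z)
    rw [hA', sub_self, ha.map_zero, one_mul] at this
    rw [hκ, hM, this]
  have h3 : ∀ z, a (κ z) = a z * c (ε (M z)) := by
    intro z
    have := heq (ε (A' z)) (A' z)
    rw [sub_self, hc.map_zero, mul_one, add_comm (ε (A' z)) (A' z), hA'] at this
    rw [hM, _root_.map_add, this, ← ha.map_neg, hκ, neg_sub]
  have hcκ : ∀ z, c (κ z) = c z := hc.apply_eq_of_apply_le κ fun z => by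
    rw [h1]
    exact mul_le_of_le_one_left (hc.nonneg z) (ha.le_one _)
  have haκ : ∀ z, a (κ z) = a z := ha.apply_eq_of_apply_le κ fun z => by
    rw [h3]
    exact mul_le_of_le_one_right (ha.nonneg z) (hc.le_one _)
  have hca : ∀ z, c z ≠ 0 → a (M z) = 1 := fun z hz => by
    have := h1 z
    rw [hcκ] at this
    exact mul_right_cancel₀ hz (by rw [one_mul]; exact this.symm)
  have hac : ∀ z, a z ≠ 0 → c (ε (M z)) = 1 := fun z hz => by
    have := h3 z
    rw [haκ] at this
    exact mul_left_cancel₀ hz (by rw [mul_one]; exact this.symm)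
  have hone : ∀ {r : ℝ}, r = 1 → r ≠ 0 := fun h => by rw [h]; exact one_ne_zero
  -- Chaining `hca` and `hac`, the map `ε M M` sends the support of `c` into `{c = 1}`. Being a
  -- permutation of a finite set that preserves `{c = 1}`, it also reflects membership in it.
  have hc01 : ∀ z, c z ≠ 0 → c z = 1 := by
    intro z hz
    have hinj : Function.Injective (ε * M * M : AddMonoid.End F) := hεMinj.comp hMinj
    have hstep : ∀ z, c z ≠ 0 → c ((ε * M * M : AddMonoid.End F) z) = 1 := fun z hz =>
      hac _ (hone (hca z hz))
    exact (apply_iff_of_injective hinj (p := fun z => c z = 1)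
      (fun z hz => hstep z (hone hz)) z).mp (hstep z hz)
  have ha01 : ∀ z, a z ≠ 0 → a z = 1 := by
    intro z hz
    have hinj : Function.Injective (M * (ε * M) : AddMonoid.End F) := hMinj.comp hεMinj
    have hstep : ∀ z, a z ≠ 0 → a ((M * (ε * M) : AddMonoid.End F) z) = 1 := fun z hz =>
      hca _ (hone (hac z hz))
    exact (apply_iff_of_injective hinj (p := fun z => a z = 1)
      (fun z hz => hstep z (hone hz)) z).mp (hstep z hz)
  have haM : ∀ z, a (M z) = 1 ↔ a z = 1 := apply_iff_of_injective hMinj (p := fun z => a z = 1)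
    fun z hz => by rw [hMκ, ha.map_add _ _ ((haκ z).trans hz), hz]
  have hcM : ∀ z, c (M z) = 1 ↔ c z = 1 := apply_iff_of_injective hMinj (p := fun z => c z = 1)
    fun z hz => by rw [hMκ, hc.map_add _ _ ((hcκ z).trans hz), hz]
  have hMsurj : Function.Surjective M := Finite.injective_iff_surjective.mp hMinj
  -- Doubling `A' + ε A' = 1` gives `ε M = 2 - M`; as `M` is onto, invariance under `ε` follows from
  -- invariance under `M`.
  have hεM : ∀ z, ε (M z) = z + z - M z := by
    intro z
    rw [hM, _root_.map_add]
    have h := hA' z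
    generalize A' z = t at h ⊢
    rw [← h]
    abel
  have haε : ∀ z, a (ε z) = 1 ↔ a z = 1 := apply_iff_of_injective hε (p := fun z => a z = 1) (by
    intro z hz
    obtain ⟨t, rfl⟩ := hMsurj z
    have ht := (haM t).mp hz
    rw [hεM, sub_eq_add_neg, ha.map_add _ _ ((ha.map_neg _).trans hz), ha.map_add _ _ ht, ht])
  have hcε : ∀ z, c (ε z) = 1 ↔ c z = 1 := apply_iff_of_injective hε (p := fun z => c z = 1) (by
    intro z hz
    obtain ⟨t, rfl⟩ := hMsurj z
    have ht := (hcM t).mp hz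
    rw [hεM, sub_eq_add_neg, hc.map_add _ _ ((hc.map_neg _).trans hz), hc.map_add _ _ ht, ht])
  refine ⟨?_, ⟨fun h => ?_, fun h => ?_⟩, ?_, haε w⟩
  · by_cases h : a w = 0
    · exact Or.inl h
    · exact Or.inr (ha01 w h)
  · rw [← hcM, ← hcε]
    exact hac w (hone h)
  · rw [← haM]
    exact hca w (hone h)
  · by_cases h : c w = 0
    · exact Or.inl h
    · exact Or.inr (hc01 w h)

end FiniteEquation

/-! ### Products of finite groups of coprime odd orders -/

/-- The multiples of every integer have finite index up to torsion, and there are finitely many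
elements of every order. -/
structure IsFinitePrimary (X : Type*) [AddCommGroup X] : Prop where
  finite_torsion : ∀ N : ℕ, 0 < N → {x : X | N • x = 0}.Finite
  exists_decomposition : ∀ m : ℕ, 0 < m → ∃ N : ℕ, 0 < N ∧
    ∀ x : X, ∃ s t : X, N • s = 0 ∧ x = s + m • t

lemma finite_primes_dvd {m : ℕ} (hm : 0 < m) :
    {p : {p : ℕ // p.Prime ∧ 2 < p} | (p : ℕ) ∣ m}.Finite := by
  have : (Subtype.val '' {p : {p : ℕ // p.Prime ∧ 2 < p} | (p : ℕ) ∣ m}).Finite := by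
    refine (Set.finite_Iic m).subset ?_
    rintro _ ⟨p, hp, rfl⟩
    exact Nat.le_of_dvd hm hp
  exact this.of_finite_image Subtype.val_injective.injOn

/-- Only finitely many coordinates have `p ∣ m`; on the others multiplication by `m` is bijective.
The first kind carries the torsion and supplies `s`, the second supplies `t`. -/
lemma isFinitePrimary_pi {A : {p : ℕ // p.Prime ∧ 2 < p} → Type*} [∀ p, AddCommGroup (A p)]
    (hfin : ∀ p, Finite (A p)) (hA : ∀ p, ∀ x : A p, ∃ k : ℕ, addOrderOf x = (p : ℕ) ^ k) :
    IsFinitePrimary (∀ p, A p) := by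
  classical
  constructor
  · intro m hm
    have hzero : ∀ x : (∀ p, A p), m • x = 0 →
        ∀ p : {p : ℕ // p.Prime ∧ 2 < p}, ¬ (p : ℕ) ∣ m → x p = 0 := by
      intro x hx p hp
      obtain ⟨k, hk⟩ := hA p (x p)
      have h1 : addOrderOf (x p) ∣ m := addOrderOf_dvd_of_nsmul_eq_zero (congrFun hx p)
      have hcop : Nat.Coprime ((p : ℕ) ^ k) m :=
        Nat.Coprime.pow_left k ((Nat.Prime.coprime_iff_not_dvd p.2.1).mpr hp)
      rw [hk] at h1
      have := Nat.Coprime.eq_one_of_dvd hcop h1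
      rw [← AddMonoid.addOrderOf_eq_one_iff, hk, this]
    have := (finite_primes_dvd hm).to_subtype
    let r : {x : (∀ p, A p) | m • x = 0} →
        (∀ p : {p : {p : ℕ // p.Prime ∧ 2 < p} | (p : ℕ) ∣ m}, A p) := fun x p => x.1 p
    have hr : Function.Injective r := by
      intro x z h
      apply Subtype.ext
      funext p
      by_cases hp : (p : ℕ) ∣ m
      · exact congrFun h ⟨p, hp⟩
      · rw [hzero x.1 x.2 p hp, hzero z.1 z.2 p hp]
    exact Finite.of_injective r hr
  · intro m hm
    refine ⟨∏ p ∈ (finite_primes_dvd hm).toFinset, Nat.card (A p),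
      Finset.prod_pos fun p _ => Nat.card_pos, fun x => ?_⟩
    have hdiv : ∀ p, ∃ t : A p, ¬ (p : ℕ) ∣ m → m • t = x p := by
      intro p
      by_cases hp : (p : ℕ) ∣ m
      · exact ⟨0, fun h => absurd hp h⟩
      · obtain ⟨k, hk⟩ := hA p (x p)
        have hcop : Nat.Coprime m (addOrderOf (x p)) := by
          rw [hk]
          exact (Nat.Coprime.pow_left k ((Nat.Prime.coprime_iff_not_dvd p.2.1).mpr hp)).symm
        obtain ⟨n, hn⟩ := exists_nsmul_eq_self_of_coprime hcop
        exact ⟨n • x p, fun _ => by rw [nsmul_left_comm]; exact hn⟩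
    choose t ht using hdiv
    refine ⟨fun p => if (p : ℕ) ∣ m then x p else 0, fun p => if (p : ℕ) ∣ m then 0 else t p, ?_, ?_⟩
    · funext p
      simp only [Pi.smul_apply, Pi.zero_apply]
      split_ifs with hp
      · have hd : Nat.card (A p) ∣ ∏ p ∈ (finite_primes_dvd hm).toFinset, Nat.card (A p) :=
          Finset.dvd_prod_of_mem _ ((finite_primes_dvd hm).mem_toFinset.mpr hp)
        obtain ⟨c, hc⟩ := hd
        rw [hc, mul_comm, mul_nsmul', card_nsmul_eq_zero', nsmul_zero]
      · exact nsmul_zero _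
    · funext p
      simp only [Pi.add_apply, Pi.smul_apply]
      split_ifs with hp
      · simp
      · rw [ht p hp, zero_add]

lemma IsFinitePrimary.of_addEquiv {X Z : Type*} [AddCommGroup X] [AddCommGroup Z] (e : X ≃+ Z)
    (h : IsFinitePrimary Z) : IsFinitePrimary X := by
  constructor
  · intro N hN
    refine Set.Finite.of_finite_image ((h.finite_torsion N hN).subset ?_)
      (e.injective.injOn (s := {x : X | N • x = 0}))
    rintro _ ⟨x, hx, rfl⟩
    change N • e x = 0
    rw [← map_nsmul, show N • x = 0 from hx, map_zero]
  · intro m hm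
    obtain ⟨N, hN, hdec⟩ := h.exists_decomposition m hm
    refine ⟨N, hN, fun x => ?_⟩
    obtain ⟨s, t, hs, hx⟩ := hdec (e x)
    refine ⟨e.symm s, e.symm t, ?_, ?_⟩
    · rw [← map_nsmul, hs, map_zero]
    · apply e.injective
      rw [map_add, map_nsmul, e.apply_symm_apply, e.apply_symm_apply, hx]

lemma IsProductOfFiniteOddPGroups.isFinitePrimary {X : Type*} [AddCommGroup X]
    [TopologicalSpace X] (h : IsProductOfFiniteOddPGroups X) : IsFinitePrimary X := by
  obtain ⟨A, _, _, -, hfin, hA, ⟨e⟩⟩ := h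
  exact (isFinitePrimary_pi hfin hA).of_addEquiv e.toAddEquiv

section Primary

variable {X : Type*} [AddCommGroup X]

/-- An injective endomorphism is surjective on the elements of a given order. -/
lemma IsFinitePrimary.exists_preimage (h : IsFinitePrimary X) {N : ℕ} (hN : 0 < N) (φ : X →+ X)
    (hφ : Function.Injective φ) {s : X} (hs : N • s = 0) : ∃ s' : X, φ s' = s := by
  have := (h.finite_torsion N hN).to_subtype
  let r : {x : X | N • x = 0} → {x : X | N • x = 0} := fun x =>
    ⟨φ x.1, by
      change N • φ x.1 = 0
      rw [← map_nsmul, show N • x.1 = 0 from x.2, map_zero]⟩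
  have hr : Function.Injective r := fun a b hab =>
    Subtype.ext (hφ (congrArg Subtype.val hab))
  obtain ⟨s', hs'⟩ := Finite.injective_iff_surjective.mp hr ⟨s, hs⟩
  exact ⟨s'.1, congrArg Subtype.val hs'⟩

variable [TopologicalSpace X]

/-- A character killed by `m` is trivial on `mX`, and the decomposition makes `X / mX` an image of
the finite `N`-torsion. -/
lemma IsFinitePrimary.finite_charTorsion (h : IsFinitePrimary X) {m : ℕ} (hm : 0 < m) :
    {y : contChar X | m • y = 0}.Finite := by
  obtain ⟨N, hN, hdec⟩ := h.exists_decomposition m hm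
  have hfin := (h.finite_torsion N hN).to_subtype
  let V : AddSubgroup X := (nsmulAddMonoidHom m : X →+ X).range
  have : Finite (X ⧸ V) := by
    refine Finite.of_surjective
      (fun s : {x : X | N • x = 0} => (QuotientAddGroup.mk s.1 : X ⧸ V)) ?_
    intro q
    obtain ⟨x, rfl⟩ := QuotientAddGroup.mk_surjective q
    obtain ⟨s, t, hs, rfl⟩ := hdec x
    refine ⟨⟨s, hs⟩, ?_⟩
    rw [QuotientAddGroup.eq]
    exact ⟨t, by simp⟩
  refine (contChar.finite_setOf_trivial_on V).subset ?_
  rintro y hy _ ⟨x, rfl⟩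
  have : (m • y) x = 1 := by
    rw [show m • y = 0 from hy]; rfl
  simpa using this

/-- A torsion character that is trivial on the image of an injective endomorphism is trivial. -/
lemma IsFinitePrimary.char_eq_zero (h : IsFinitePrimary X) {m : ℕ} (hm : 0 < m) {y : contChar X}
    (hy : m • y = 0) (φ : X →+ X) (hφ : Function.Injective φ) (hyφ : ∀ x, y (φ x) = 1) :
    y = 0 := by
  obtain ⟨N, hN, hdec⟩ := h.exists_decomposition m hm
  refine contChar.ext fun x => ?_
  obtain ⟨s, t, hs, rfl⟩ := hdec x
  obtain ⟨s', rfl⟩ := h.exists_preimage hN φ hφ hs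
  have : (m • y) t = 1 := by rw [hy]; rfl
  rw [contChar.nsmul_apply] at this
  rw [contChar.map_add, hyφ, contChar.map_nsmul, this, one_mul, contChar.zero_apply]

end Primary

lemma isCharNorm_fourierTransform {X : Type*} [AddCommGroup X] [TopologicalSpace X]
    [MeasurableSpace X] [BorelSpace X] (μ : Measure X) [IsProbabilityMeasure μ]
    (F : AddSubgroup (contChar X)) :
    IsCharNorm fun y : F => ‖fourierTransform μ y.1‖ where
  map_zero := by simp [fourierTransform.zero_apply]
  nonneg _ := norm_nonneg _
  le_one _ := fourierTransform.norm_le_one μ _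
  map_neg _ := fourierTransform.norm_neg_apply μ _
  map_add _ _ h := fourierTransform.norm_add_of_norm_eq_one μ h _

/-! ### From product structure to a common Haar distribution -/

section Main

variable {X : Type*} [AddCommGroup X] [TopologicalSpace X] [IsTopologicalAddGroup X]
  [CompactSpace X] [TotallyDisconnectedSpace X] [MeasurableSpace X] [BorelSpace X]

/-- The solutions of the functional equation on the character group. -/
lemma norm_fourierTransform_of_functional_equation (hX : ∀ x : X, addOrderOf x ≠ 2)
    (hfp : IsFinitePrimary X) (α : X ≃ₜ+ X) (hα : KerOneAddTrivial α) (μ₁ μ₂ : Measure X)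
    [IsProbabilityMeasure μ₁] [IsProbabilityMeasure μ₂]
    (heq : ∀ u v : contChar X,
      fourierTransform μ₁ (u + v) *
        fourierTransform μ₂ (u + contChar.comap α.toAddEquiv.toAddMonoidHom α.continuous v) =
      fourierTransform μ₁ (u - v) *
        fourierTransform μ₂ (u - contChar.comap α.toAddEquiv.toAddMonoidHom α.continuous v))
    (w : contChar X) :
    (‖fourierTransform μ₁ w‖ = 0 ∨ ‖fourierTransform μ₁ w‖ = 1) ∧
    (‖fourierTransform μ₁ w‖ = 1 ↔ ‖fourierTransform μ₂ w‖ = 1) ∧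
    (‖fourierTransform μ₂ w‖ = 0 ∨ ‖fourierTransform μ₂ w‖ = 1) ∧
    (‖fourierTransform μ₁ (contChar.comap α.toAddEquiv.toAddMonoidHom α.continuous w)‖ = 1 ↔
      ‖fourierTransform μ₁ w‖ = 1) := by
  set e := contChar.comap α.toAddEquiv.toAddMonoidHom α.continuous with he
  obtain ⟨m, hm, hmw⟩ := contChar.exists_nsmul_eq_zero w
  -- The `m`-torsion is finite, contains `w` and is preserved by the adjoint, so the equation
  -- restricts to it.
  let F : AddSubgroup (contChar X) := (nsmulAddMonoidHom m : contChar X →+ contChar X).ker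
  have hF : ∀ y, y ∈ F ↔ m • y = 0 := fun y => Iff.rfl
  have : Finite F := (hfp.finite_charTorsion hm).to_subtype
  let ε : AddMonoid.End F :=
    (e.comp F.subtype).codRestrict F fun y => by
      rw [hF]
      change m • e y.1 = 0
      rw [← _root_.map_nsmul, (hF _).mp y.2, _root_.map_zero]
  have hεapply : ∀ y : F, (ε y).1 = e y.1 := fun y => rfl
  have hε : Function.Injective ε := by
    rw [injective_iff_map_eq_zero]
    intro y hy
    apply Subtype.ext
    refine contChar.ext fun x => ?_
    have h1 : e y.1 = 0 := congrArg Subtype.val hy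
    have h2 : e y.1 (α.symm x) = y.1 x := by
      change y.1 (α (α.symm x)) = y.1 x
      rw [α.apply_symm_apply]
    rw [← h2, h1]
    rfl
  have hone : Function.Injective (AddMonoidHom.id X + α.toAddEquiv.toAddMonoidHom) :=
    (AddMonoidHom.ker_eq_bot_iff _).mp hα
  have hA : Function.Injective (1 + ε : AddMonoid.End F) := by
    rw [injective_iff_map_eq_zero]
    intro y hy
    apply Subtype.ext
    refine hfp.char_eq_zero hm ((hF _).mp y.2) _ hone fun x => ?_
    have h1 : y.1 + e y.1 = 0 := congrArg Subtype.val hy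
    have h2 : (y.1 + e y.1) x = 1 := by rw [h1]; rfl
    rw [contChar.add_apply] at h2
    rw [AddMonoidHom.add_apply, contChar.map_add]
    exact h2
  have hdouble : Function.Injective (nsmulAddMonoidHom 2 : X →+ X) := by
    rw [injective_iff_map_eq_zero]
    intro x hx
    by_contra hne
    exact hX x (addOrderOf_eq_prime hx hne)
  have h2 : ∀ y : F, y + y = 0 → y = 0 := by
    intro y hy
    apply Subtype.ext
    refine hfp.char_eq_zero hm ((hF _).mp y.2) _ hdouble fun x => ?_
    have h1 : y.1 + y.1 = 0 := congrArg Subtype.val hy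
    have h3 : (y.1 + y.1) x = 1 := by rw [h1]; rfl
    rw [contChar.add_apply, ← pow_two] at h3
    rw [nsmulAddMonoidHom_apply, contChar.map_nsmul, h3]
  exact finite_functional_equation (isCharNorm_fourierTransform μ₁ F)
    (isCharNorm_fourierTransform μ₂ F) ε hε hA h2
    (fun u v => by
      have := congrArg norm (heq u.1 v.1)
      rwa [norm_mul, norm_mul] at this) ⟨w, (hF w).mpr hmw⟩

/-- Both transforms have modulus one on the same set `H` and vanish off it, so one annihilator
serves both. Invariance of `H` under the adjoint and its inverse dualises to `α (K) = K`. -/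
theorem exists_common_haar_shift [T2Space X] [SecondCountableTopology X] (hX : ∀ x : X, addOrderOf x ≠ 2)
    (hfp : IsFinitePrimary X) (α : X ≃ₜ+ X) (hα : KerOneAddTrivial α)
    {Ω : Type*} [MeasurableSpace Ω] (P : Measure Ω) [IsProbabilityMeasure P] (ξ₁ ξ₂ : Ω → X)
    (h₁ : Measurable ξ₁) (h₂ : Measurable ξ₂) (hind : IndepFun ξ₁ ξ₂ P)
    (hsymm : CondDistribSymmetric (fun ω => ξ₁ ω + α (ξ₂ ω)) (fun ω => ξ₁ ω + ξ₂ ω) P) :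
    ∃ (K : AddSubgroup X) (_ : CompactSpace K),
      IsShiftOfHaar K (P.map ξ₁) ∧ IsShiftOfHaar K (P.map ξ₂) ∧
      K.map α.toAddEquiv.toAddMonoidHom = K := by
  have := Measure.isProbabilityMeasure_map (μ := P) h₁.aemeasurable
  have := Measure.isProbabilityMeasure_map (μ := P) h₂.aemeasurable
  have heq := (condDistribSymmetric_iff_fourierTransform h₁ h₂ hind
    α.toAddEquiv.toAddMonoidHom α.continuous).mp hsymm
  have key := norm_fourierTransform_of_functional_equation hX hfp α hα _ _ heq
  set e := contChar.comap α.toAddEquiv.toAddMonoidHom α.continuous with he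
  let H : Set (contChar X) := {y | ‖fourierTransform (P.map ξ₁) y‖ = 1}
  have hH : ∀ y, y ∈ H ↔ ‖fourierTransform (P.map ξ₁) y‖ = 1 := fun y => Iff.rfl
  refine ⟨charAnnihilator H, inferInstance, ?_, ?_, ?_⟩
  · refine isShiftOfHaar_charAnnihilator _ H (fun y hy => hy) fun y hy => ?_
    exact norm_eq_zero.mp ((key y).1.resolve_right hy)
  · refine isShiftOfHaar_charAnnihilator _ H (fun y hy => (key y).2.1.mp hy) fun y hy => ?_
    exact norm_eq_zero.mp ((key y).2.2.1.resolve_right fun h => hy ((key y).2.1.mpr h))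
  · ext x
    rw [AddSubgroup.mem_map]
    constructor
    · rintro ⟨z, hz, rfl⟩ y hy
      exact hz (e y) ((key y).2.2.2.mpr hy)
    · intro hx
      refine ⟨α.symm x, fun y hy => ?_, α.apply_symm_apply x⟩
      let z : contChar X := contChar.comap α.symm.toAddEquiv.toAddMonoidHom α.symm.continuous y
      have hez : e z = y := by
        refine contChar.ext fun t => ?_
        change y (α.symm (α t)) = y t
        rw [α.symm_apply_apply]
      have hz : z ∈ H := by
        rw [hH, ← (key z).2.2.2, hez]
        exact hy
      exact hx z hz

end Main

/-! ### Counterexamples -/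

/-- A direct summand of `Y` (the image of `proj`), with a surjective locally nilpotent
endomorphism `nil` of it and a nonzero element `elt`. -/
structure NilpotentSummand (Y : Type*) [AddCommGroup Y] where
  proj : Y →+ Y
  nil : Y →+ Y
  elt : Y
  proj_proj : ∀ y, proj (proj y) = proj y
  proj_nil : ∀ y, proj (nil y) = nil y
  nil_proj : ∀ y, nil (proj y) = nil y
  exists_nil_eq : ∀ y, ∃ z, nil z = proj y
  exists_iterate_eq_zero : ∀ y, ∃ n : ℕ, nil^[n] y = 0
  elt_ne_zero : elt ≠ 0
  proj_elt : proj elt = elt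
  nil_eq_zero : ∀ v, proj v = v → ∀ n : ℤ, v + v - nil v = n • elt → nil v = 0

namespace NilpotentSummand

section Algebra

variable {Y : Type*} [AddCommGroup Y] (N : NilpotentSummand Y)

lemma eq_zero_of_nil_eq {v : Y} (h : N.nil v = v) : v = 0 := by
  obtain ⟨n, hn⟩ := N.exists_iterate_eq_zero v
  rw [← hn]
  exact (Function.iterate_fixed h n).symm

/-- The solution is `-(w + nil w + nil² w + ⋯)`, a finite sum by local nilpotency. -/
lemma exists_nil_sub_eq {w : Y} (hw : N.proj w = w) : ∃ z, N.proj z = z ∧ N.nil z - z = w := by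
  obtain ⟨n, hn⟩ := N.exists_iterate_eq_zero w
  induction n generalizing w with
  | zero => exact ⟨0, map_zero _, by rw [map_zero, sub_zero]; exact hn.symm⟩
  | succ n ih =>
    obtain ⟨z, hz, h⟩ := ih (N.proj_nil w) hn
    refine ⟨z - w, by rw [map_sub, hz, hw], ?_⟩
    rw [map_sub, ← h]
    abel

/-- The automorphism equal to `nil - 1` on the summand and to the identity on its complement. -/
def autHom : Y →+ Y := AddMonoidHom.id Y - N.proj - N.proj + N.nil

lemma autHom_apply (y : Y) : N.autHom y = y - N.proj y - N.proj y + N.nil y := rfl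

lemma autHom_bijective : Function.Bijective N.autHom := by
  constructor
  · rw [injective_iff_map_eq_zero]
    intro y hy
    rw [autHom_apply] at hy
    have h1 := congrArg N.proj hy
    rw [map_add, map_sub, map_sub, N.proj_proj, N.proj_nil, map_zero, sub_self, zero_sub,
      neg_add_eq_zero] at h1
    have h2 : N.proj y = 0 := N.eq_zero_of_nil_eq (by rw [N.nil_proj, ← h1])
    rwa [← h1, h2, sub_zero, sub_zero, add_zero] at hy
  · intro y
    obtain ⟨z, hz, h⟩ := N.exists_nil_sub_eq (N.proj_proj y)
    refine ⟨y - N.proj y + z, ?_⟩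
    have hp : N.proj (y - N.proj y + z) = z := by
      rw [map_add, map_sub, N.proj_proj, sub_self, zero_add, hz]
    have hn : N.nil (y - N.proj y + z) = N.nil z := by
      rw [map_add, map_sub, N.nil_proj, sub_self, zero_add]
    have hnz : N.nil z = N.proj y + z := by rw [← h]; abel
    rw [autHom_apply, hp, hn, hnz]
    abel

/-- The automorphism equal to `nil - 1` on the summand and to the identity on its complement. -/
noncomputable def aut : Y ≃+ Y := AddEquiv.ofBijective N.autHom N.autHom_bijective

lemma aut_apply (y : Y) : N.aut y = y - N.proj y - N.proj y + N.nil y := rfl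

/-- On the summand `1 + aut` is `nil`, on the complement it is doubling, and both are onto. Dually,
`I + α` is injective. -/
lemma exists_add_aut_eq (h2 : ∀ y : Y, ∃ z, z + z = y) (y : Y) : ∃ z, z + N.aut z = y := by
  obtain ⟨t, ht⟩ := h2 y
  obtain ⟨s, hs⟩ := N.exists_nil_eq y
  refine ⟨t - N.proj t + N.proj s, ?_⟩
  have hp : N.proj (t - N.proj t + N.proj s) = N.proj s := by
    rw [map_add, map_sub, N.proj_proj, N.proj_proj, sub_self, zero_add]
  have hn : N.nil (t - N.proj t + N.proj s) = N.proj t + N.proj t := by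
    rw [map_add, map_sub, N.nil_proj, N.nil_proj, sub_self, zero_add, hs, ← map_add, ht]
  rw [aut_apply, hp, hn, ← ht]
  abel

open Classical in
/-- The Fourier coefficients of the density `1 + Re elt / 2`. -/
noncomputable def coeff (y : Y) : ℂ :=
  (if y = 0 then 1 else 0) + (1 / 4) * (if y + N.elt = 0 then 1 else 0) +
    (1 / 4) * (if y - N.elt = 0 then 1 else 0)

lemma exists_zsmul_eq_of_coeff_ne_zero {y : Y} (h : N.coeff y ≠ 0) : ∃ n : ℤ, y = n • N.elt := by
  by_contra! hcon
  apply h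
  have h0 : y ≠ 0 := by simpa using hcon 0
  have h1 : y + N.elt ≠ 0 := fun h => hcon (-1) (by
    rw [neg_smul, one_smul]; exact eq_neg_of_add_eq_zero_left h)
  have h2 : y - N.elt ≠ 0 := fun h => hcon 1 (by rw [one_smul]; exact sub_eq_zero.mp h)
  rw [coeff, if_neg h0, if_neg h1, if_neg h2]
  simp

lemma coeff_zero : N.coeff 0 = 1 := by
  rw [coeff, if_pos rfl, zero_add, if_neg N.elt_ne_zero, zero_sub,
    if_neg (neg_ne_zero.mpr N.elt_ne_zero)]
  simp

lemma norm_coeff_elt : ‖N.coeff N.elt‖ ≠ 0 ∧ ‖N.coeff N.elt‖ ≠ 1 := by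
  rw [coeff, if_neg N.elt_ne_zero, sub_self, if_pos rfl]
  split_ifs <;> norm_num

/-- On either side the two arguments differ by `±(2v - nil v)`. If a side is nonzero, both its
arguments are multiples of `elt`, so `nil_eq_zero` gives `nil v = 0`; then `nil v - v = -v` and the
sides agree by commutativity. -/
lemma coeff_equation_of_proj_eq (u v : Y) (hv : N.proj v = v) :
    N.coeff (u + v) * N.coeff (u + (N.nil v - v)) =
      N.coeff (u - v) * N.coeff (u - (N.nil v - v)) := by
  by_cases hnil : N.nil v = 0
  · rw [hnil, zero_sub, sub_neg_eq_add, ← sub_eq_add_neg, mul_comm]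
  · have hz : ∀ a b : Y, a - b = v + v - N.nil v → N.coeff a * N.coeff b = 0 := by
      intro a b hab
      by_contra hne
      obtain ⟨m, hm⟩ := N.exists_zsmul_eq_of_coeff_ne_zero (left_ne_zero_of_mul hne)
      obtain ⟨n, hn⟩ := N.exists_zsmul_eq_of_coeff_ne_zero (right_ne_zero_of_mul hne)
      exact hnil (N.nil_eq_zero v hv (m - n) (by rw [← hab, hm, hn, sub_smul]))
    rw [hz _ _ (by abel), mul_comm, hz _ _ (by abel)]

lemma coeff_equation (u v : Y) :
    N.coeff (N.proj (u + v)) * N.coeff (N.proj (u + N.aut v)) =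
      N.coeff (N.proj (u - v)) * N.coeff (N.proj (u - N.aut v)) := by
  have h : N.proj (N.aut v) = N.nil (N.proj v) - N.proj v := by
    rw [aut_apply, map_add, map_sub, map_sub, N.proj_proj, N.proj_nil, N.nil_proj]
    abel
  rw [map_add, map_add, map_sub, map_sub, h]
  exact N.coeff_equation_of_proj_eq _ _ (N.proj_proj v)

end Algebra

section Measure

variable {X : Type*} [AddCommGroup X] [TopologicalSpace X] (N : NilpotentSummand (contChar X))

/-- The density `1 + Re elt / 2`. -/
noncomputable def density (x : X) : ℝ := 1 + (N.elt x : ℂ).re / 2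

lemma density_nonneg (x : X) : 0 ≤ N.density x := by
  have h := Complex.abs_re_le_norm (N.elt x : ℂ)
  rw [Circle.norm_coe] at h
  have := (abs_le.mp h).1
  rw [density]
  linarith

lemma measurable_density [MeasurableSpace X] [BorelSpace X] : Measurable N.density :=
  ((Complex.measurable_re.comp (fourierTransform.measurable_char N.elt)).div_const 2).const_add 1

lemma density_mul (x : X) (y : contChar X) :
    (N.density x : ℂ) * (y x : ℂ) =
      (y x : ℂ) + (1 / 4) * ((y + N.elt) x : ℂ) + (1 / 4) * ((y - N.elt) x : ℂ) := by
  rw [sub_eq_add_neg, contChar.add_apply, contChar.add_apply, contChar.neg_apply, Circle.coe_mul,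
    Circle.coe_mul, Circle.coe_inv_eq_conj, density]
  have := Complex.add_conj (N.elt x : ℂ)
  push_cast at this ⊢
  linear_combination (-(y x : ℂ) / 4) * this

variable [IsTopologicalAddGroup X] [CompactSpace X] [MeasurableSpace X] [BorelSpace X]

lemma integral_density_mul (y : contChar X) :
    ∫ x, (N.density x : ℂ) * (y x : ℂ) ∂(Measure.addHaarMeasure (⊤ : PositiveCompacts X)) =
      N.coeff y := by
  simp_rw [density_mul]
  have hi := fourierTransform.integrable_char (Measure.addHaarMeasure (⊤ : PositiveCompacts X))
  have key := fourierTransform_addHaarMeasure_top (X := X)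
  simp only [fourierTransform] at key
  have hi1 : Integrable (fun x => (1 / 4 : ℂ) * ((y + N.elt) x : ℂ))
      (Measure.addHaarMeasure (⊤ : PositiveCompacts X)) := (hi _).const_mul _
  have hi2 : Integrable (fun x => (1 / 4 : ℂ) * ((y - N.elt) x : ℂ))
      (Measure.addHaarMeasure (⊤ : PositiveCompacts X)) := (hi _).const_mul _
  have hi3 : Integrable (fun x => (y x : ℂ) + (1 / 4 : ℂ) * ((y + N.elt) x : ℂ))
      (Measure.addHaarMeasure (⊤ : PositiveCompacts X)) := (hi y).add hi1
  rw [integral_add hi3 hi2, integral_add (hi y) hi1, integral_const_mul, integral_const_mul, key, key,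
    key, coeff]
  congr

/-- The distribution with density `1 + Re elt / 2` with respect to the Haar measure. -/
noncomputable def densityMeasure : Measure X :=
  (Measure.addHaarMeasure (⊤ : PositiveCompacts X)).withDensity
    fun x => ENNReal.ofReal (N.density x)

lemma integral_densityMeasure (y : contChar X) :
    ∫ x, (y x : ℂ) ∂N.densityMeasure = N.coeff y := by
  rw [densityMeasure, integral_withDensity_eq_integral_toReal_smul
    N.measurable_density.ennreal_ofReal (Filter.Eventually.of_forall fun x => ENNReal.ofReal_lt_top),
    ← integral_density_mul]
  congr 1
  ext x
  rw [ENNReal.toReal_ofReal (N.density_nonneg x)]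
  rfl

instance isProbabilityMeasure_densityMeasure : IsProbabilityMeasure N.densityMeasure := by
  constructor
  have hintg : Integrable N.density (Measure.addHaarMeasure (⊤ : PositiveCompacts X)) :=
    (integrable_const 1).add
      ((fourierTransform.integrable_char _ N.elt).re.div_const 2)
  have h1 : ∫ x, N.density x ∂(Measure.addHaarMeasure (⊤ : PositiveCompacts X)) = 1 := by
    have h := N.integral_density_mul 0
    simp only [contChar.zero_apply, Circle.coe_one, mul_one] at h
    rw [coeff_zero] at h
    have h' := (integral_ofReal (𝕜 := ℂ) (f := N.density)
      (μ := Measure.addHaarMeasure (⊤ : PositiveCompacts X))).symm.trans h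
    exact Complex.ofReal_eq_one.mp h'
  rw [densityMeasure, withDensity_apply _ MeasurableSet.univ, Measure.restrict_univ,
    ← ofReal_integral_eq_lintegral_ofReal hintg
      (Filter.Eventually.of_forall fun x => N.density_nonneg x), h1, ENNReal.ofReal_one]

/-- A nilpotent summand of the character group gives a distribution that is not a shift of a Haar
distribution, and satisfies the functional equation together with an automorphism. -/
theorem exists_counterexample [T2Space X] [TotallyDisconnectedSpace X]
    (N : NilpotentSummand (contChar X)) (h2 : ∀ y : contChar X, ∃ z, z + z = y) :
    ∃ α : X ≃ₜ+ X, KerOneAddTrivial α ∧ ∃ μ : Measure X, IsProbabilityMeasure μ ∧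
      μ ∉ haarShifts X ∧ ∀ u v : contChar X,
        fourierTransform μ (u + v) *
          fourierTransform μ (u + contChar.comap α.toAddEquiv.toAddMonoidHom α.continuous v) =
        fourierTransform μ (u - v) *
          fourierTransform μ (u - contChar.comap α.toAddEquiv.toAddMonoidHom α.continuous v) := by
  obtain ⟨a, hac, ha⟩ := contChar.exists_adjoint N.aut.toAddMonoidHom
  obtain ⟨a', hac', ha'⟩ := contChar.exists_adjoint N.aut.symm.toAddMonoidHom
  obtain ⟨q, hqc, hq⟩ := contChar.exists_adjoint N.proj
  let α : X ≃ₜ+ X :=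
    { toFun := a
      invFun := a'
      left_inv := fun x => contChar.eq_of_forall_apply_eq fun y => by
        rw [ha']
        change (N.aut.symm y) (a x) = y x
        rw [ha]
        change N.aut (N.aut.symm y) x = y x
        rw [AddEquiv.apply_symm_apply]
      right_inv := fun x => contChar.eq_of_forall_apply_eq fun y => by
        rw [ha]
        change (N.aut y) (a' x) = y x
        rw [ha']
        change N.aut.symm (N.aut y) x = y x
        rw [AddEquiv.symm_apply_apply]
      map_add' := a.map_add
      continuous_toFun := hac
      continuous_invFun := hac' }
  have hα : ∀ v : contChar X,
      contChar.comap α.toAddEquiv.toAddMonoidHom α.continuous v = N.aut v :=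
    fun v => contChar.ext fun x => ha v x
  refine ⟨α, ?_, N.densityMeasure.map q,
    Measure.isProbabilityMeasure_map hqc.measurable.aemeasurable, ?_, ?_⟩
  · rw [KerOneAddTrivial, AddMonoidHom.ker_eq_bot_iff, injective_iff_map_eq_zero]
    intro x hx
    refine contChar.eq_of_forall_apply_eq fun y => ?_
    obtain ⟨z, rfl⟩ := N.exists_add_aut_eq h2 y
    rw [contChar.map_zero, contChar.add_apply, ← hα]
    change z x * z (α x) = 1
    rw [← contChar.map_add, show x + α x = 0 from hx, contChar.map_zero]
  all_goals
    have hft : ∀ y : contChar X, fourierTransform (N.densityMeasure.map q) y =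
        N.coeff (N.proj y) := by
      intro y
      rw [fourierTransform.map_apply hqc.measurable, ← integral_densityMeasure]
      simp_rw [hq]
  · intro hmem
    have := norm_fourierTransform_of_mem_haarShifts hmem N.elt
    rw [hft, N.proj_elt] at this
    exact this.elim N.norm_coeff_elt.1 N.norm_coeff_elt.2
  · intro u v
    simp only [hα, hft]
    exact N.coeff_equation u v

end Measure

end NilpotentSummand

/-- On a standard Borel space, every distribution is the common law of two independent random
variables on a probability space in a given universe. -/
lemma exists_indepFun_map_eq {X : Type u} [MeasurableSpace X] [StandardBorelSpace X] [Nonempty X]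
    (μ : Measure X) [IsProbabilityMeasure μ] :
    ∃ (Ω : Type v) (_ : MeasurableSpace Ω) (P : Measure Ω) (_ : IsProbabilityMeasure P)
      (ξ₁ ξ₂ : Ω → X), Measurable ξ₁ ∧ Measurable ξ₂ ∧ IndepFun ξ₁ ξ₂ P ∧
        P.map ξ₁ = μ ∧ P.map ξ₂ = μ := by
  -- Passing through the real line frees the sample space from the universe of `X`: it becomes a
  -- lift of `ℝ × ℝ`, and `g` is a measurable left inverse of the embedding.
  obtain ⟨f, hf⟩ := exists_measurableEmbedding_real X
  obtain ⟨g, hg, hgf⟩ := hf.exists_measurable_extend measurable_id fun _ => inferInstance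
  have hgf' : (μ.map f).map g = μ := by
    rw [Measure.map_map hg hf.measurable, hgf, Measure.map_id]
  have := Measure.isProbabilityMeasure_map (μ := μ) hf.measurable.aemeasurable
  have h1 : Measurable fun ω : ULift.{v} (ℝ × ℝ) => g ω.down.1 :=
    hg.comp (measurable_fst.comp measurable_down)
  have h2 : Measurable fun ω : ULift.{v} (ℝ × ℝ) => g ω.down.2 :=
    hg.comp (measurable_snd.comp measurable_down)
  have hP := Measure.isProbabilityMeasure_map (μ := (μ.map f).prod (μ.map f))
    (f := (ULift.up : ℝ × ℝ → ULift.{v} (ℝ × ℝ))) measurable_up.aemeasurable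
  have hjoint : Measure.map (fun ω : ULift.{v} (ℝ × ℝ) => (g ω.down.1, g ω.down.2))
      (((μ.map f).prod (μ.map f)).map ULift.up) = μ.prod μ := by
    rw [Measure.map_map (h1.prodMk h2) measurable_up]
    conv_rhs => rw [← hgf', Measure.map_prod_map _ _ hg hg]
    rfl
  have e1 : Measure.map (fun ω : ULift.{v} (ℝ × ℝ) => g ω.down.1)
      (((μ.map f).prod (μ.map f)).map ULift.up) = μ := by
    have := congrArg Measure.fst hjoint
    rwa [Measure.fst_map_prodMk h2, Measure.fst_prod] at this
  have e2 : Measure.map (fun ω : ULift.{v} (ℝ × ℝ) => g ω.down.2)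
      (((μ.map f).prod (μ.map f)).map ULift.up) = μ := by
    have := congrArg Measure.snd hjoint
    rwa [Measure.snd_map_prodMk h1, Measure.snd_prod] at this
  refine ⟨ULift.{v} (ℝ × ℝ), inferInstance, ((μ.map f).prod (μ.map f)).map ULift.up, hP,
    _, _, h1, h2, ?_, e1, e2⟩
  rw [indepFun_iff_map_prod_eq_prod_map_map h1.aemeasurable h2.aemeasurable, e1, e2, hjoint]

/-! ### Divisible summands -/

section Divisible

variable {Y : Type u} [AddCommGroup Y]

lemma eq_zero_of_isCoprime_zsmul {m n : ℤ} (h : IsCoprime m n) {y : Y} (hm : m • y = 0)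
    (hn : n • y = 0) : y = 0 := by
  obtain ⟨a, b, hab⟩ := h
  rw [← one_zsmul y, ← hab, add_smul, mul_smul, mul_smul, hm, hn, smul_zero, smul_zero, add_zero]

/-- Write `n = p ^ j * r` with `r` prime to `p`: the power of `p` is handled by hypothesis, and `r`
is invertible modulo `p ^ k` by Bézout. -/
lemma exists_zsmul_eq_of_primary_divisible {p : ℕ} (hp : p.Prime) (D : AddSubgroup Y)
    (hprim : ∀ d ∈ D, ∃ k : ℕ, p ^ k • d = 0) (hdiv : ∀ d ∈ D, ∃ d' ∈ D, p • d' = d)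
    {n : ℤ} (hn : n ≠ 0) {d : Y} (hd : d ∈ D) : ∃ d' ∈ D, n • d' = d := by
  have hpow : ∀ (j : ℕ) (d : Y), d ∈ D → ∃ d' ∈ D, (p : ℤ) ^ j • d' = d := by
    intro j
    induction j with
    | zero => exact fun d hd => ⟨d, hd, by simp⟩
    | succ j ih =>
      intro d hd
      obtain ⟨d₁, hd₁, rfl⟩ := hdiv d hd
      obtain ⟨d₂, hd₂, rfl⟩ := ih d₁ hd₁
      refine ⟨d₂, hd₂, ?_⟩
      rw [pow_succ', mul_smul, natCast_zsmul]
  have hpz : Prime (p : ℤ) := Nat.prime_iff_prime_int.mp hp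
  have hfin : FiniteMultiplicity (p : ℤ) n :=
    Int.finiteMultiplicity_iff.mpr ⟨by simpa using hp.ne_one, hn⟩
  obtain ⟨r, hr, hndvd⟩ := hfin.exists_eq_pow_mul_and_not_dvd
  obtain ⟨d₁, hd₁, h₁⟩ := hpow (multiplicity (p : ℤ) n) d hd
  obtain ⟨k, hk⟩ := hprim d₁ hd₁
  have hcop : IsCoprime r ((p : ℤ) ^ k) :=
    ((hpz.coprime_iff_not_dvd.mpr hndvd).symm).pow_right
  obtain ⟨a, b, hab⟩ := hcop
  refine ⟨a • d₁, D.zsmul_mem hd₁ a, ?_⟩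
  have hk' : ((p : ℤ) ^ k) • d₁ = 0 := by
    rw [← hk, ← natCast_zsmul, Nat.cast_pow]
  have h₂ : (r * a) • d₁ = d₁ := by
    conv_rhs => rw [← one_zsmul d₁, ← hab, add_smul, mul_smul b, hk', smul_zero, add_zero]
    rw [mul_comm]
  rw [hr, mul_smul, ← mul_smul r, h₂, h₁]

/-- A divisible primary subgroup is a direct summand. -/
lemma exists_retraction_of_primary_divisible {p : ℕ} (hp : p.Prime) (D : AddSubgroup Y)
    (hprim : ∀ d ∈ D, ∃ k : ℕ, p ^ k • d = 0) (hdiv : ∀ d ∈ D, ∃ d' ∈ D, p • d' = d) :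
    ∃ π : Y →+ Y, (∀ y, π y ∈ D) ∧ ∀ d ∈ D, π d = d := by
  have key : ∀ (d : D) (n : ℤ), ∃ d' : D, n ≠ 0 → n • d' = d := by
    intro d n
    by_cases hn : n = 0
    · exact ⟨0, fun h => absurd hn h⟩
    · obtain ⟨d', hd', h⟩ := exists_zsmul_eq_of_primary_divisible hp D hprim hdiv hn d.2
      exact ⟨⟨d', hd'⟩, fun _ => Subtype.ext h⟩
  classical
  choose f hf using key
  let _ : DivisibleBy D ℤ :=
    { div := fun d n => if n = 0 then 0 else f d n
      div_zero := fun d => if_pos rfl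
      div_cancel := fun {n} d hn => by
        rw [if_neg hn]
        exact hf d n hn }
  have hinj : CategoryTheory.Injective (AddCommGrpCat.of D) :=
    AddCommGrpCat.injective_of_divisible D
  let i : AddCommGrpCat.of D ⟶ AddCommGrpCat.of Y := AddCommGrpCat.ofHom D.subtype
  have hmono : CategoryTheory.Mono i :=
    (AddCommGrpCat.mono_iff_injective i).mpr Subtype.val_injective
  let r := CategoryTheory.Injective.factorThru (CategoryTheory.CategoryStruct.id _) i
  have hr : CategoryTheory.CategoryStruct.comp i r = CategoryTheory.CategoryStruct.id _ :=
    CategoryTheory.Injective.comp_factorThru _ _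
  refine ⟨D.subtype.comp r.hom, fun y => (r.hom y).2, fun d hd => ?_⟩
  have := congrArg (fun g => g.hom (⟨d, hd⟩ : D)) hr
  exact congrArg Subtype.val this

lemma two_sub_sq_isCoprime {p : ℕ} (hp : p.Prime) (hp2 : p ≠ 2) (k : ℕ) :
    IsCoprime (2 - (p : ℤ) * p) ((p : ℤ) ^ k) := by
  apply IsCoprime.pow_right
  have h : IsCoprime ((2 : ℕ) : ℤ) (p : ℤ) :=
    Nat.isCoprime_iff_coprime.mpr ((Nat.coprime_primes Nat.prime_two hp).mpr hp2.symm)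
  obtain ⟨a, b, hab⟩ := h
  refine ⟨a, b + a * p, ?_⟩
  push_cast at hab
  linear_combination hab

/-- Take `nil = p²` on `D` and `elt` of order `p`. From `(2 - p²) v = n • elt` one gets `(2 - p²) p
v = 0`; for odd `p` the first factor is prime to `p`, so `p v = 0`, and for `p = 2` this reads `4 v
= 0`. Multiplication by `p` itself would fail at `p = 2`, where `2 - p = 0`. -/
theorem nonempty_nilpotentSummand_of_divisible {p : ℕ} (hp : p.Prime) (D : AddSubgroup Y)
    (hprim : ∀ d ∈ D, ∃ k : ℕ, p ^ k • d = 0) (hdiv : ∀ d ∈ D, ∃ d' ∈ D, p • d' = d)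
    (hD : D ≠ ⊥) : Nonempty (NilpotentSummand Y) := by
  obtain ⟨π, hπ, hπD⟩ := exists_retraction_of_primary_divisible hp D hprim hdiv
  obtain ⟨χ, hχD, hχ0, hχp⟩ : ∃ χ ∈ D, χ ≠ 0 ∧ p • χ = 0 := by
    obtain ⟨d, hd0⟩ := D.ne_bot_iff_exists_ne_zero.mp hD
    have hex := hprim d d.2
    classical
    have hspec := Nat.find_spec hex
    have hpos : Nat.find hex ≠ 0 := by
      intro h0
      rw [h0, pow_zero, one_smul] at hspec
      exact hd0 (Subtype.ext hspec)
    obtain ⟨k, hk⟩ := Nat.exists_eq_succ_of_ne_zero hpos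
    refine ⟨p ^ k • (d : Y), D.nsmul_mem d.2 _, Nat.find_min hex (by omega), ?_⟩
    rw [← mul_smul, ← pow_succ', ← Nat.succ_eq_add_one, ← hk, hspec]
  let nil : Y →+ Y := (nsmulAddMonoidHom (p * p)).comp π
  have hnil : ∀ y, nil y = (p * p) • π y := fun y => rfl
  have hnilD : ∀ y, nil y ∈ D := fun y => D.nsmul_mem (hπ y) _
  have hiter : ∀ (n : ℕ) (d : Y), d ∈ D → p ^ n • d = 0 → nil^[n] d = 0 := by
    intro n
    induction n with
    | zero => intro d _ h; simpa using h
    | succ n ih =>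
      intro d hd h
      refine ih (nil d) (hnilD d) ?_
      rw [hnil, hπD d hd, ← mul_smul, ← mul_assoc, ← pow_succ, mul_comm, mul_smul, h, smul_zero]
  refine ⟨⟨π, nil, χ, fun y => hπD _ (hπ y), fun y => hπD _ (hnilD y), fun y => ?_, fun y => ?_,
    fun y => ?_, hχ0, hπD χ hχD, fun v hv n h => ?_⟩⟩
  · rw [hnil, hnil, hπD _ (hπ y)]
  · obtain ⟨d₁, hd₁, h₁⟩ := hdiv _ (hπ y)
    obtain ⟨d₂, hd₂, h₂⟩ := hdiv _ hd₁
    refine ⟨d₂, ?_⟩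
    rw [hnil, hπD d₂ hd₂, mul_smul, h₂, h₁]
  · obtain ⟨k, hk⟩ := hprim _ (hnilD y)
    exact ⟨k + 1, hiter k _ (hnilD y) hk⟩
  · rw [hnil, hv] at h ⊢
    have hvD : v ∈ D := hv ▸ hπ v
    have h1 : (2 - (p : ℤ) * p) • ((p : ℤ) • v) = 0 := by
      have h2 : (2 - (p : ℤ) * p) • v = n • χ := by
        rw [← h, sub_smul, two_smul, ← Nat.cast_mul, natCast_zsmul]
      rw [smul_comm, h2, smul_comm, natCast_zsmul, hχp, smul_zero]
    by_cases hp2 : p = 2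
    · subst hp2
      rw [← mul_smul] at h1
      have h3 : (-4 : ℤ) • v = 0 := h1
      have h4 : (4 : ℤ) • v = 0 := by rwa [neg_smul, neg_eq_zero] at h3
      exact_mod_cast h4
    · obtain ⟨k, hk⟩ := hprim v hvD
      have hpv : (p : ℤ) • v = 0 := by
        refine eq_zero_of_isCoprime_zsmul (two_sub_sq_isCoprime hp hp2 k) h1 ?_
        rw [smul_comm, ← Nat.cast_pow, natCast_zsmul, natCast_zsmul, hk, smul_zero]
      rw [mul_smul, ← natCast_zsmul v p, hpv, smul_zero]

end Divisible

/-! ### Infinite direct sums of cyclic summands -/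

section SumHom

variable {Y : Type*} [AddCommGroup Y]

lemma hasFiniteSupport_of_eventually_zero {M : Type*} [Zero M] {f : ℕ → M}
    (h : ∃ N, ∀ k, N ≤ k → f k = 0) : Function.HasFiniteSupport f := by
  obtain ⟨N, hN⟩ := h
  refine (Set.finite_Iio N).subset fun k hk => ?_
  by_contra hlt
  exact hk (hN k (not_lt.mp hlt))

/-- The sum of a locally finite sequence of endomorphisms. -/
noncomputable def sumHom (g : ℕ → (Y →+ Y)) (h : ∀ y, ∃ N, ∀ k, N ≤ k → g k y = 0) : Y →+ Y where
  toFun y := ∑ᶠ k, g k y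
  map_zero' := by simp
  map_add' a b := by
    simp only [map_add]
    exact finsum_add_distrib (hasFiniteSupport_of_eventually_zero (h a))
      (hasFiniteSupport_of_eventually_zero (h b))

lemma sumHom_apply (g : ℕ → (Y →+ Y)) (h : ∀ y, ∃ N, ∀ k, N ≤ k → g k y = 0) (y : Y) :
    sumHom g h y = ∑ᶠ k, g k y := rfl

lemma map_sumHom {Z : Type*} [AddCommGroup Z] (g : ℕ → (Y →+ Y))
    (h : ∀ y, ∃ N, ∀ k, N ≤ k → g k y = 0) (θ : Y →+ Z) (y : Y) :
    θ (sumHom g h y) = ∑ᶠ k, θ (g k y) :=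
  θ.map_finsum (hasFiniteSupport_of_eventually_zero (h y))

lemma sumHom_mem (g : ℕ → (Y →+ Y)) (h : ∀ y, ∃ N, ∀ k, N ≤ k → g k y = 0) (S : AddSubgroup Y)
    (y : Y) (hS : ∀ k, g k y ∈ S) : sumHom g h y ∈ S := by
  rw [sumHom_apply]
  exact finsum_induction (· ∈ S) S.zero_mem (fun _ _ => S.add_mem) hS

end SumHom

/-- A biorthogonal sequence of cyclic direct summands of nondecreasing prime power orders. -/
structure CyclicSystem (p : ℕ) (Y : Type*) [AddCommGroup Y] where
  n : ℕ → ℕ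
  le_succ : ∀ k, n k ≤ n (k + 1)
  φ : ∀ k, Y →+ ZMod (p ^ (n k + 1))
  ψ : ∀ k, ZMod (p ^ (n k + 1)) →+ Y
  φ_ψ_self : ∀ k a, φ k (ψ k a) = a
  φ_ψ_of_ne : ∀ i k, i ≠ k → ∀ a, φ i (ψ k a) = 0
  exists_φ_eq_zero : ∀ y, ∃ N, ∀ k, N ≤ k → φ k y = 0

namespace CyclicSystem

variable {p : ℕ} {Y : Type*} [AddCommGroup Y] (C : CyclicSystem p Y)

/-- The reduction map between consecutive cyclic groups. -/
def red (k : ℕ) : ZMod (p ^ (C.n (k + 1) + 1)) →+ ZMod (p ^ (C.n k + 1)) :=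
  (ZMod.castHom (pow_dvd_pow p (Nat.succ_le_succ (C.le_succ k))) _).toAddMonoidHom

lemma red_surjective (k : ℕ) : Function.Surjective (C.red k) :=
  ZMod.castHom_surjective (pow_dvd_pow p (Nat.succ_le_succ (C.le_succ k)))

/-- The projection onto the sum of the cyclic summands. -/
noncomputable def proj : Y →+ Y :=
  sumHom (fun k => (C.ψ k).comp (C.φ k)) fun y => by
    obtain ⟨N, hN⟩ := C.exists_φ_eq_zero y
    exact ⟨N, fun k hk => by rw [AddMonoidHom.comp_apply, hN k hk, map_zero]⟩

/-- The backward shift on the sum of the cyclic summands. -/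
noncomputable def shift : Y →+ Y :=
  sumHom (fun k => (C.ψ k).comp ((C.red k).comp (C.φ (k + 1)))) fun y => by
    obtain ⟨N, hN⟩ := C.exists_φ_eq_zero y
    refine ⟨N, fun k hk => ?_⟩
    rw [AddMonoidHom.comp_apply, AddMonoidHom.comp_apply, hN (k + 1) (by omega), map_zero,
      map_zero]

lemma proj_apply (y : Y) : C.proj y = ∑ᶠ k, C.ψ k (C.φ k y) := rfl

lemma shift_apply (y : Y) : C.shift y = ∑ᶠ k, C.ψ k (C.red k (C.φ (k + 1) y)) := rfl

lemma φ_proj (i : ℕ) (y : Y) : C.φ i (C.proj y) = C.φ i y := by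
  rw [proj, map_sumHom, finsum_eq_single _ i]
  · exact C.φ_ψ_self i _
  · exact fun k hk => C.φ_ψ_of_ne i k hk.symm _

lemma φ_shift (i : ℕ) (y : Y) : C.φ i (C.shift y) = C.red i (C.φ (i + 1) y) := by
  rw [shift, map_sumHom, finsum_eq_single _ i]
  · exact C.φ_ψ_self i _
  · exact fun k hk => C.φ_ψ_of_ne i k hk.symm _

lemma proj_ψ (k : ℕ) (a : ZMod (p ^ (C.n k + 1))) : C.proj (C.ψ k a) = C.ψ k a := by
  rw [proj_apply, finsum_eq_single _ k, φ_ψ_self]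
  intro i hi
  rw [C.φ_ψ_of_ne i k hi, map_zero]

lemma shift_ψ_succ (k : ℕ) (a : ZMod (p ^ (C.n (k + 1) + 1))) :
    C.shift (C.ψ (k + 1) a) = C.ψ k (C.red k a) := by
  rw [shift_apply, finsum_eq_single _ k, φ_ψ_self]
  intro i hi
  rw [C.φ_ψ_of_ne (i + 1) (k + 1) (by omega), map_zero, map_zero]

lemma shift_ψ_zero (a : ZMod (p ^ (C.n 0 + 1))) : C.shift (C.ψ 0 a) = 0 := by
  rw [shift_apply]
  refine (finsum_congr fun i => ?_).trans finsum_zero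
  rw [C.φ_ψ_of_ne (i + 1) 0 (by omega), map_zero, map_zero]

lemma proj_shift (y : Y) : C.proj (C.shift y) = C.shift y := by
  rw [proj_apply]
  conv_rhs => rw [shift_apply]
  exact finsum_congr fun k => by rw [φ_shift]

lemma shift_iterate_eq_zero (N : ℕ) (y : Y) (h : ∀ k, N ≤ k → C.φ k y = 0) :
    C.shift^[N + 1] y = 0 := by
  induction N generalizing y with
  | zero =>
    change C.shift y = 0
    rw [shift_apply]
    refine (finsum_congr fun k => ?_).trans finsum_zero
    rw [h (k + 1) (by omega), map_zero, map_zero]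
  | succ N ih =>
    refine ih (C.shift y) fun k hk => ?_
    rw [φ_shift, h (k + 1) (by omega), map_zero]

/-- For odd `p`, twice the identity minus the shift is injective. -/
lemma eq_zero_of_two_eq_shift (hp : p.Prime) (hp2 : p ≠ 2) {w : Y} (hw : C.proj w = w)
    (h : w + w = C.shift w) : w = 0 := by
  obtain ⟨N, hN⟩ := C.exists_φ_eq_zero w
  -- Descending induction on the coordinate: twice the `k`-th coordinate is the reduction of the
  -- next one, and 2 is a unit.
  have hφ : ∀ j k, N ≤ k + j → C.φ k w = 0 := by
    intro j
    induction j with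
    | zero => exact fun k hk => hN k hk
    | succ j ih =>
      intro k hk
      have h1 := congrArg (C.φ k) h
      rw [φ_shift, ih (k + 1) (by omega), map_zero, map_add, ← two_mul] at h1
      have hu : IsUnit ((2 : ℕ) : ZMod (p ^ (C.n k + 1))) := by
        rw [ZMod.isUnit_iff_coprime]
        exact Nat.Coprime.pow_right _ ((Nat.coprime_primes Nat.prime_two hp).mpr hp2.symm)
      rw [Nat.cast_two] at hu
      exact hu.mul_right_eq_zero.mp h1
  rw [← hw, proj_apply]
  refine (finsum_congr fun k => ?_).trans finsum_zero
  rw [hφ N k (by omega), map_zero]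

/-- The nilpotent summand given by the backward shift. -/
noncomputable def nilpotentSummand (hp : p.Prime) (hp2 : p ≠ 2) : NilpotentSummand Y where
  proj := C.proj
  nil := C.shift
  elt := C.ψ 0 1
  proj_proj y := by
    rw [proj_apply]
    conv_rhs => rw [proj_apply]
    exact finsum_congr fun k => by rw [φ_proj]
  proj_nil := C.proj_shift
  nil_proj y := by
    rw [shift_apply, shift_apply]
    exact finsum_congr fun k => by rw [φ_proj]
  exists_nil_eq y := by
    refine sumHom_mem _ _ C.shift.range y fun k => ?_
    obtain ⟨a, ha⟩ := C.red_surjective k (C.φ k y)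
    refine ⟨C.ψ (k + 1) a, ?_⟩
    rw [shift_ψ_succ, ha]
    rfl
  exists_iterate_eq_zero y := by
    obtain ⟨N, hN⟩ := C.exists_φ_eq_zero y
    exact ⟨N + 1, C.shift_iterate_eq_zero N y hN⟩
  elt_ne_zero h := by
    have h1 := congrArg (C.φ 0) h
    rw [φ_ψ_self, map_zero] at h1
    have : Fact (1 < p ^ (C.n 0 + 1)) := ⟨Nat.one_lt_pow (by omega) hp.one_lt⟩
    exact one_ne_zero h1
  proj_elt := C.proj_ψ 0 1
  -- The shift kills `ψ 0 1`; applied to `h` it leaves `w + w = shift w` for `w = shift v`.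
  nil_eq_zero v _ m h := by
    refine C.eq_zero_of_two_eq_shift hp hp2 (C.proj_shift v) ?_
    have := congrArg C.shift h
    rw [map_sub, map_add, map_zsmul, shift_ψ_zero, smul_zero, sub_eq_zero] at this
    exact this

end CyclicSystem

/-! ### Splitting off one cyclic summand -/

section Existence

variable {Y : Type*} [AddCommGroup Y]

/-- The subgroup of multiples of `m`. -/
def multiples (Y : Type*) [AddCommGroup Y] (m : ℕ) : AddSubgroup Y :=
  (nsmulAddMonoidHom m : Y →+ Y).range

lemma nsmul_mem_multiples (m : ℕ) (y : Y) : m • y ∈ multiples Y m := ⟨y, rfl⟩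

lemma mem_multiples {m : ℕ} {y : Y} : y ∈ multiples Y m ↔ ∃ t, m • t = y := Iff.rfl

/-- The map from `ℤ/N` to the `N`-torsion of `ℚ/ℤ`. -/
lemma exists_zmod_hom_of_character {N : ℕ} (hN : 0 < N) (c : Y →+ AddCircle (1 : ℚ))
    (hc : ∀ y, N • c y = 0) :
    ∃ φ : Y →+ ZMod N, ∀ y (m : ℤ), m • φ y = 0 ↔ m • c y = 0 := by
  have : Fact ((0 : ℚ) < 1) := ⟨zero_lt_one⟩
  set g : AddCircle (1 : ℚ) := ((1 / N : ℚ) : AddCircle (1 : ℚ)) with hg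
  have hgord : addOrderOf g = N := by
    have := AddCircle.addOrderOf_div_of_gcd_eq_one (p := (1 : ℚ)) (m := 1) hN (Nat.gcd_one_left N)
    simpa [hg] using this
  have hNg : N • g = 0 := by rw [← hgord]; exact addOrderOf_nsmul_eq_zero g
  let j : ZMod N →+ AddCircle (1 : ℚ) :=
    ZMod.lift N ⟨zmultiplesHom _ g, by simpa using hNg⟩
  have hj : ∀ m : ℤ, j (m : ZMod N) = m • g := fun m => by simp [j]
  have hjinj : Function.Injective j := by
    rw [injective_iff_map_eq_zero]
    intro a ha
    obtain ⟨m, rfl⟩ := ZMod.intCast_surjective a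
    rw [hj, ← addOrderOf_dvd_iff_zsmul_eq_zero, hgord] at ha
    exact (ZMod.intCast_zmod_eq_zero_iff_dvd m N).mpr ha
  have hex : ∀ y, ∃ a : ZMod N, j a = c y := by
    intro y
    obtain ⟨m, -, hm⟩ := (AddCircle.nsmul_eq_zero_iff hN).mp (hc y)
    refine ⟨((m : ℤ) : ZMod N), ?_⟩
    rw [hj, ← hm, hg, natCast_zsmul, ← AddCircle.coe_nsmul]
    congr 1
    rw [nsmul_eq_mul]
    ring
  choose φ hφ using hex
  refine ⟨{ toFun := φ, map_zero' := hjinj (by rw [hφ, map_zero, map_zero]),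
            map_add' := fun a b => hjinj (by rw [hφ, map_add, map_add, hφ, hφ]) }, ?_⟩
  intro y m
  change m • φ y = 0 ↔ _
  rw [← hφ, ← map_zsmul, map_eq_zero_iff j hjinj]

lemma isUnit_of_nsmul_ne_zero {p n : ℕ} (hp : p.Prime) {a : ZMod (p ^ (n + 1))}
    (h : p ^ n • a ≠ 0) : IsUnit a := by
  have : NeZero (p ^ (n + 1)) := ⟨(pow_pos hp.pos _).ne'⟩
  obtain ⟨m, rfl⟩ := ZMod.natCast_zmod_surjective a
  rw [ZMod.isUnit_iff_coprime]
  refine Nat.Coprime.pow_right _ (Nat.Coprime.symm ((Nat.Prime.coprime_iff_not_dvd hp).mpr ?_))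
  rintro ⟨r, rfl⟩
  apply h
  rw [nsmul_eq_mul, ← Nat.cast_mul, ← mul_assoc, ← pow_succ, Nat.cast_mul, ZMod.natCast_self,
    zero_mul]

/-- An element `z` whose multiple `p ^ n • z` does not lie in `W + p ^ (n + 1) • Y` generates a
cyclic summand; the projection can be chosen trivial on `W`. -/
lemma exists_hom_zmod {p : ℕ} (hp : p.Prime) (n : ℕ) (W : AddSubgroup Y) (z : Y)
    (hz : p ^ n • z ∉ W ⊔ multiples Y (p ^ (n + 1))) :
    ∃ φ : Y →+ ZMod (p ^ (n + 1)), (∀ w ∈ W, φ w = 0) ∧ φ z = 1 := by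
  set V := W ⊔ multiples Y (p ^ (n + 1)) with hV
  have hne : (QuotientAddGroup.mk (p ^ n • z) : Y ⧸ V) ≠ 0 := by
    rwa [Ne, QuotientAddGroup.eq_zero_iff]
  -- A character trivial on `p ^ (n + 1) • Y` factors through `ZMod (p ^ (n + 1))`. Its being
  -- nonzero at `p ^ n • z` makes the value at `z` a unit, which is then normalised to 1.
  obtain ⟨c₀, hc₀⟩ := CharacterModule.exists_character_apply_ne_zero_of_ne_zero hne
  let c : Y →+ AddCircle (1 : ℚ) := (c₀ : (Y ⧸ V) →+ AddCircle (1 : ℚ)).comp (QuotientAddGroup.mk' V)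
  have hcV : ∀ w ∈ V, c w = 0 := by
    intro w hw
    change c₀ (QuotientAddGroup.mk w) = 0
    rw [(QuotientAddGroup.eq_zero_iff w).mpr hw]
    exact map_zero c₀
  have hcN : ∀ y, p ^ (n + 1) • c y = 0 := by
    intro y
    rw [← map_nsmul]
    exact hcV _ (AddSubgroup.mem_sup_right (nsmul_mem_multiples _ y))
  obtain ⟨φ, hφ⟩ := exists_zmod_hom_of_character (pow_pos hp.pos (n + 1)) c hcN
  have hu : IsUnit (φ z) := by
    apply isUnit_of_nsmul_ne_zero hp
    intro h
    apply hc₀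
    change c (p ^ n • z) = 0
    have := (hφ z ((p ^ n : ℕ) : ℤ)).mp (by rw [natCast_zsmul]; exact h)
    rwa [map_nsmul, ← natCast_zsmul]
  obtain ⟨a, ha⟩ := hu.exists_left_inv
  refine ⟨(AddMonoidHom.mulLeft a).comp φ, fun w hw => ?_, ha⟩
  have : φ w = 0 := by
    have := (hφ w 1).mpr (by rw [one_zsmul]; exact hcV w (AddSubgroup.mem_sup_left hw))
    rwa [one_zsmul] at this
  rw [AddMonoidHom.comp_apply, this, map_zero]

end Existence

/-! ### Existence of nilpotent summands -/

/-- A cyclic direct summand of prime power order. -/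
structure CyclicSummand (p : ℕ) (Y : Type*) [AddCommGroup Y] where
  n : ℕ
  φ : Y →+ ZMod (p ^ (n + 1))
  ψ : ZMod (p ^ (n + 1)) →+ Y
  φ_ψ : ∀ a, φ (ψ a) = a

/-- A finite list of biorthogonal cyclic summands, with exponents in `M`, the latest first, where
the `k`-th projection vanishes at the first `k` terms of the sequence `t`. -/
def IsBiorthogonal {p : ℕ} {Y : Type*} [AddCommGroup Y] (M : Set ℕ) (t : ℕ → Y) :
    List (CyclicSummand p Y) → Prop
  | [] => True
  | a :: l => a.n ∈ M ∧
      (∀ b ∈ l, b.n ≤ a.n ∧ (∀ x, a.φ (b.ψ x) = 0) ∧ ∀ x, b.φ (a.ψ x) = 0) ∧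
      (∀ j < l.length, a.φ (t j) = 0) ∧ IsBiorthogonal M t l

namespace IsBiorthogonal

variable {p : ℕ} {Y : Type*} [AddCommGroup Y] {M : Set ℕ} {t : ℕ → Y}

lemma φ_list_sum {l : List (CyclicSummand p Y)} (hl : IsBiorthogonal M t l) (z : Y) :
    ∀ b ∈ l, b.φ ((l.map fun b => b.ψ (b.φ z)).sum) = b.φ z := by
  induction l with
  | nil => exact fun b hb => absurd hb List.not_mem_nil
  | cons a l ih =>
    obtain ⟨-, horth, -, hl'⟩ := hl
    intro b hb
    rw [List.map_cons, List.sum_cons, map_add]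
    rcases List.mem_cons.mp hb with rfl | hb
    · have h0 : (l.map fun b => b.ψ (b.φ z)).sum ∈ b.φ.ker := by
        refine AddSubgroup.list_sum_mem _ fun x hx => ?_
        obtain ⟨c, hc, rfl⟩ := List.mem_map.mp hx
        exact (horth c hc).2.1 _
      rw [b.φ_ψ, (AddMonoidHom.mem_ker).mp h0, add_zero]
    · rw [(horth b hb).2.2, zero_add, ih hl' b hb]

lemma exists_bound {l : List (CyclicSummand p Y)} (hl : IsBiorthogonal M t l)
    (hM : M.Nonempty) : ∃ m ∈ M, ∀ b ∈ l, b.n ≤ m := by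
  cases l with
  | nil =>
    obtain ⟨m, hm⟩ := hM
    exact ⟨m, hm, fun b hb => absurd hb List.not_mem_nil⟩
  | cons a l =>
    refine ⟨a.n, hl.1, fun b hb => ?_⟩
    rcases List.mem_cons.mp hb with rfl | hb
    · exact le_rfl
    · exact (hl.2.1 b hb).1

/-- Let `L` be the finite group generated by the earlier summands and the relevant terms of `t`. The
generator `z₀` from `hH` is corrected by its components in the earlier summands; the correction lies
in `L`, so the height condition survives, and its order divides `p ^ (n + 1)` because the exponents
do not decrease. The new projection is chosen trivial on `L`. -/
lemma exists_cons (hp : p.Prime) (hY : ∀ y : Y, ∃ m : ℕ, 0 < m ∧ m • y = 0)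
    (hM : M.Nonempty)
    (hH : ∀ m ∈ M, ∀ L : AddSubgroup Y, Finite L → ∃ n ∈ M, m ≤ n ∧ ∃ z : Y,
      p ^ (n + 1) • z = 0 ∧ p ^ n • z ∉ L ⊔ multiples Y (p ^ (n + 1)))
    {l : List (CyclicSummand p Y)} (hl : IsBiorthogonal M t l) :
    ∃ a, IsBiorthogonal M t (a :: l) := by
  classical
  obtain ⟨m, hmM, hm⟩ := hl.exists_bound hM
  let s : Finset Y := (Finset.range l.length).image t ∪ (l.map fun b => b.ψ 1).toFinset
  let L : AddSubgroup Y := AddSubgroup.closure (s : Set Y)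
  have hfin : Finite L := finite_closure_of_torsion hY s
  have htL : ∀ j < l.length, t j ∈ L := fun j hj =>
    AddSubgroup.subset_closure (Finset.mem_coe.mpr (Finset.mem_union_left _
      (Finset.mem_image_of_mem t (Finset.mem_range.mpr hj))))
  have hψL : ∀ b ∈ l, ∀ x, b.ψ x ∈ L := by
    intro b hb x
    have h1 : b.ψ 1 ∈ L :=
      AddSubgroup.subset_closure (Finset.mem_coe.mpr (Finset.mem_union_right _
        (List.mem_toFinset.mpr (List.mem_map.mpr ⟨b, hb, rfl⟩))))
    obtain ⟨k, rfl⟩ := ZMod.intCast_surjective x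
    rw [← zsmul_one k, map_zsmul]
    exact L.zsmul_mem h1 k
  obtain ⟨n, hnM, hmn, z₀, hz₀, hz₀L⟩ := hH m hmM L hfin
  set S := (l.map fun b => b.ψ (b.φ z₀)).sum with hS
  have hSL : S ∈ L := by
    refine AddSubgroup.list_sum_mem _ fun x hx => ?_
    obtain ⟨b, hb, rfl⟩ := List.mem_map.mp hx
    exact hψL b hb _
  have hSn : p ^ (n + 1) • S = 0 := by
    have : S ∈ (nsmulAddMonoidHom (p ^ (n + 1)) : Y →+ Y).ker := by
      refine AddSubgroup.list_sum_mem _ fun x hx => ?_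
      obtain ⟨b, hb, rfl⟩ := List.mem_map.mp hx
      obtain ⟨d, hd⟩ := pow_dvd_pow p (Nat.succ_le_succ ((hm b hb).trans hmn))
      rw [AddMonoidHom.mem_ker, nsmulAddMonoidHom_apply, ← map_nsmul, hd, nsmul_eq_mul,
        Nat.cast_mul, ZMod.natCast_self, zero_mul, zero_mul, map_zero]
    exact this
  have hz : p ^ (n + 1) • (z₀ - S) = 0 := by rw [smul_sub, hz₀, hSn, sub_zero]
  have hzL : p ^ n • (z₀ - S) ∉ L ⊔ multiples Y (p ^ (n + 1)) := by
    intro h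
    apply hz₀L
    rw [← sub_add_cancel z₀ S, smul_add]
    exact add_mem h (AddSubgroup.mem_sup_left (L.nsmul_mem hSL _))
  obtain ⟨φ, hφL, hφz⟩ := exists_hom_zmod hp n L (z₀ - S) hzL
  let ψ : ZMod (p ^ (n + 1)) →+ Y :=
    ZMod.lift _ ⟨zmultiplesHom _ (z₀ - S), by
      rw [zmultiplesHom_apply, natCast_zsmul]; exact hz⟩
  have hψ : ∀ k : ℤ, ψ (k : ZMod (p ^ (n + 1))) = k • (z₀ - S) := fun k => by simp [ψ]
  refine ⟨⟨n, φ, ψ, fun a => ?_⟩, hnM, fun b hb => ⟨(hm b hb).trans hmn, fun x => ?_, fun x => ?_⟩,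
    fun j hj => hφL _ (htL j hj), hl⟩
  · obtain ⟨k, rfl⟩ := ZMod.intCast_surjective a
    rw [hψ, map_zsmul, hφz, zsmul_one]
  · exact hφL _ (hψL b hb x)
  · obtain ⟨k, rfl⟩ := ZMod.intCast_surjective x
    change b.φ (ψ k) = 0
    rw [hψ, map_zsmul, map_sub, hl.φ_list_sum z₀ b hb, sub_self, smul_zero]

end IsBiorthogonal

/-! ### Cyclic sequences, heights and divisible parts -/

section Dichotomy

/-- A sequence of cyclic summands, built one at a time. -/
theorem nonempty_cyclicSystem {p : ℕ} (hp : p.Prime) {Y : Type*} [AddCommGroup Y] [Countable Y]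
    (hY : ∀ y : Y, ∃ m : ℕ, 0 < m ∧ m • y = 0) {M : Set ℕ} (hM : M.Nonempty)
    (hH : ∀ m ∈ M, ∀ L : AddSubgroup Y, Finite L → ∃ n ∈ M, m ≤ n ∧ ∃ z : Y,
      p ^ (n + 1) • z = 0 ∧ p ^ n • z ∉ L ⊔ multiples Y (p ^ (n + 1))) :
    Nonempty (CyclicSystem p Y) := by
  obtain ⟨t, ht⟩ := exists_surjective_nat Y
  have step : ∀ l : {l : List (CyclicSummand p Y) // IsBiorthogonal M t l},
      ∃ a, IsBiorthogonal M t (a :: l.1) := fun l => l.2.exists_cons hp hY hM hH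
  choose next hnext using step
  let F : ℕ → {l : List (CyclicSummand p Y) // IsBiorthogonal M t l} := fun k =>
    Nat.rec ⟨[], trivial⟩ (fun _ l => ⟨next l :: l.1, hnext l⟩) k
  have hF : ∀ k, (F (k + 1)).1 = next (F k) :: (F k).1 := fun k => rfl
  have hlen : ∀ k, (F k).1.length = k := by
    intro k
    induction k with
    | zero => rfl
    | succ k ih => rw [hF, List.length_cons, ih]
  have hmem : ∀ i k, i < k → next (F i) ∈ (F k).1 := by
    intro i k hik
    induction k with
    | zero => omega
    | succ k ih =>
      rw [hF]
      rcases Nat.lt_succ_iff_lt_or_eq.mp hik with h | rfl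
      · exact List.mem_cons_of_mem _ (ih h)
      · exact List.mem_cons_self
  have horth := fun k => (hnext (F k)).2.1
  have htriv := fun k => (hnext (F k)).2.2.1
  exact ⟨{
    n := fun k => (next (F k)).n
    le_succ := fun k => (horth (k + 1) _ (hmem k (k + 1) (Nat.lt_succ_self k))).1
    φ := fun k => (next (F k)).φ
    ψ := fun k => (next (F k)).ψ
    φ_ψ_self := fun k => (next (F k)).φ_ψ
    φ_ψ_of_ne := fun i k hik a => by
      rcases lt_or_gt_of_ne hik with h | h
      · exact (horth k _ (hmem i k h)).2.2 a
      · exact (horth i _ (hmem k i h)).2.1 a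
    exists_φ_eq_zero := fun y => by
      obtain ⟨j, rfl⟩ := ht y
      exact ⟨j + 1, fun k hk => htriv k j (by rw [hlen]; omega)⟩ }⟩

variable {Y : Type u} [AddCommGroup Y]

lemma multiples_antitone {p : ℕ} {m n : ℕ} (h : m ≤ n) :
    multiples Y (p ^ n) ≤ multiples Y (p ^ m) := by
  rintro _ ⟨y, rfl⟩
  obtain ⟨r, rfl⟩ := Nat.exists_eq_add_of_le h
  refine ⟨p ^ r • y, ?_⟩
  rw [nsmulAddMonoidHom_apply, nsmulAddMonoidHom_apply, ← mul_smul, ← pow_add]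

/-- The `p`-primary component of `p ^ N • Y`. -/
def primaryMultiples (Y : Type u) [AddCommGroup Y] (p N : ℕ) : AddSubgroup Y where
  carrier := {y | (∃ k : ℕ, p ^ k • y = 0) ∧ y ∈ multiples Y (p ^ N)}
  zero_mem' := ⟨⟨0, smul_zero _⟩, zero_mem _⟩
  add_mem' := by
    rintro a b ⟨⟨k, hk⟩, ha⟩ ⟨⟨l, hl⟩, hb⟩
    refine ⟨⟨k + l, ?_⟩, add_mem ha hb⟩
    rw [smul_add, pow_add, mul_comm, mul_smul, hk, mul_comm, mul_smul, hl, smul_zero, smul_zero,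
      add_zero]
  neg_mem' := by
    rintro a ⟨⟨k, hk⟩, ha⟩
    exact ⟨⟨k, by rw [smul_neg, hk, neg_zero]⟩, neg_mem ha⟩

/-- If the elements of order `p` in `p ^ N • Y` have infinite height, then the `p`-primary
component of `p ^ N • Y` is divisible. -/
lemma primaryMultiples_divisible {p N : ℕ}
    (h : ∀ n, N ≤ n → ∀ z : Y, p ^ (n + 1) • z = 0 → p ^ n • z ∈ multiples Y (p ^ (n + 1)))
    {x : Y} (hx : x ∈ primaryMultiples Y p N) : ∃ x' ∈ primaryMultiples Y p N, p • x' = x := by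
  have hheight : ∀ r : ℕ, ∀ y : Y, p • y = 0 → y ∈ multiples Y (p ^ N) →
      y ∈ multiples Y (p ^ (N + r)) := by
    intro r y hy hyN
    induction r with
    | zero => exact hyN
    | succ r ih =>
      obtain ⟨z, hz⟩ := mem_multiples.mp ih
      rw [← hz]
      refine h (N + r) (by omega) z ?_
      rw [pow_succ', mul_smul, hz, hy]
  obtain ⟨⟨k, hk⟩, hxN⟩ := hx
  induction k generalizing x with
  | zero =>
    rw [pow_zero, one_smul] at hk
    exact ⟨0, zero_mem _, by rw [hk, smul_zero]⟩
  | succ k ih =>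
    -- Killed by `p`, the element `p ^ k • x` has unbounded height. Writing it as `p ^ (N + k + 1) •
    -- s`, the difference `x - p • (p ^ N • s)` is killed by `p ^ k`, which feeds the induction.
    have h1 : p ^ k • x ∈ multiples Y (p ^ (N + (k + 1))) := by
      refine hheight (k + 1) _ ?_ ((multiples Y (p ^ N)).nsmul_mem hxN _)
      rw [← mul_smul, ← pow_succ', hk]
    obtain ⟨s, hs⟩ := mem_multiples.mp h1
    have hs' : p ^ k • (p • (p ^ N • s)) = p ^ k • x := by
      rw [← hs, ← mul_smul, ← mul_smul]
      congr 1
      ring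
    have hsD : p ^ N • s ∈ primaryMultiples Y p N := by
      refine ⟨⟨k + 1 + 1, ?_⟩, nsmul_mem_multiples _ s⟩
      have : p ^ (k + 1 + 1) • p ^ N • s = p • (p ^ k • (p • (p ^ N • s))) := by
        rw [← mul_smul, ← mul_smul, ← mul_smul, ← mul_smul]
        congr 1
        ring
      rw [this, hs', ← mul_smul, ← pow_succ', hk]
    obtain ⟨x', hx', hpx'⟩ := ih (x := x - p • (p ^ N • s))
      (sub_mem hxN ((multiples Y (p ^ N)).nsmul_mem (nsmul_mem_multiples _ s) p))
      (by rw [smul_sub, hs', sub_self])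
    refine ⟨x' + p ^ N • s, add_mem hx' hsD, ?_⟩
    rw [smul_add, hpx', sub_add_cancel]

/-- Filter the elements killed by `p` by height: each layer is covered by finitely many cosets of
the next, so finiteness descends from level `N` to level 0. -/
lemma finite_torsion_of_finite_layers {p N : ℕ}
    (hN : {y : Y | p • y = 0 ∧ y ∈ multiples Y (p ^ N)}.Finite)
    (h : ∀ n : ℕ, ∃ L : AddSubgroup Y, Finite L ∧ ∀ z : Y, p ^ (n + 1) • z = 0 →
      p ^ n • z ∈ L ⊔ multiples Y (p ^ (n + 1))) :
    {y : Y | p • y = 0}.Finite := by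
  have key : ∀ r n : ℕ, n + r = N → {y : Y | p • y = 0 ∧ y ∈ multiples Y (p ^ n)}.Finite := by
    intro r
    induction r with
    | zero => rintro n rfl; exact hN
    | succ r ih =>
      intro n hn
      have hfin := ih (n + 1) (by omega)
      obtain ⟨L, hL, hLz⟩ := h n
      have hcover : {y : Y | p • y = 0 ∧ y ∈ multiples Y (p ^ n)} ⊆
          ⋃ l : L, {y : Y | (p • y = 0 ∧ y ∈ multiples Y (p ^ n)) ∧
            y - l ∈ multiples Y (p ^ (n + 1))} := by
        rintro y ⟨hy, hyn⟩
        obtain ⟨z, hz⟩ := mem_multiples.mp hyn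
        have := hLz z (by rw [pow_succ', mul_smul, hz, hy])
        rw [hz] at this
        obtain ⟨l, hl, q, hq, hlq⟩ := AddSubgroup.mem_sup.mp this
        refine Set.mem_iUnion.mpr ⟨⟨l, hl⟩, ⟨hy, hyn⟩, ?_⟩
        change y - l ∈ _
        rw [← hlq, add_sub_cancel_left]
        exact hq
      refine (Set.finite_iUnion fun l => ?_).subset hcover
      rcases Set.eq_empty_or_nonempty {y : Y | (p • y = 0 ∧ y ∈ multiples Y (p ^ n)) ∧
            y - l ∈ multiples Y (p ^ (n + 1))} with he | ⟨y₀, ⟨hy₀, -⟩, hy₀l⟩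
      · rw [he]; exact Set.finite_empty
      · refine (hfin.image fun y => y₀ + y).subset ?_
        rintro y ⟨⟨hy, -⟩, hyl⟩
        refine ⟨y - y₀, ⟨by rw [smul_sub, hy, hy₀, sub_zero], ?_⟩, add_sub_cancel _ _⟩
        have := sub_mem hyl hy₀l
        rwa [sub_sub_sub_cancel_right] at this
  refine (key N 0 (by omega)).subset fun y hy => ⟨hy, ?_⟩
  exact ⟨y, by simp⟩

lemma finite_pow_torsion {p : ℕ} (h : {y : Y | p • y = 0}.Finite) (k : ℕ) :
    {y : Y | p ^ k • y = 0}.Finite := by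
  induction k with
  | zero => simp
  | succ k ih =>
    have : {y : Y | p ^ (k + 1) • y = 0} = (fun y => p • y) ⁻¹' {y : Y | p ^ k • y = 0} := by
      ext y
      change p ^ (k + 1) • y = 0 ↔ p ^ k • p • y = 0
      rw [← mul_smul, pow_succ]
    rw [this]
    refine ih.preimage' fun b _ => ?_
    rcases Set.eq_empty_or_nonempty ((fun y : Y => p • y) ⁻¹' {b}) with he | ⟨y₀, hy₀⟩
    · rw [he]; exact Set.finite_empty
    · refine (h.image fun y => y₀ + y).subset fun y hy => ⟨y - y₀, ?_, add_sub_cancel _ _⟩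
      change p • (y - y₀) = 0
      rw [smul_sub, show p • y = b from hy, show p • y₀ = b from hy₀, sub_self]

/-- Each element of `L` either has infinite height or a finite one; take `N` beyond all the finite
ones. -/
lemma exists_height_bound {p : ℕ} (L : AddSubgroup Y) [Finite L] (m : ℕ) :
    ∃ N, m ≤ N ∧ ∀ l ∈ L, l ∈ multiples Y (p ^ N) → ∀ n, l ∈ multiples Y (p ^ n) := by
  have key : ∀ l : L, ∃ N, l.1 ∈ multiples Y (p ^ N) → ∀ n, l.1 ∈ multiples Y (p ^ n) := by
    intro l
    by_cases h : ∀ n, l.1 ∈ multiples Y (p ^ n)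
    · exact ⟨0, fun _ => h⟩
    · push Not at h
      obtain ⟨n, hn⟩ := h
      exact ⟨n, fun h => absurd h hn⟩
  choose f hf using key
  obtain ⟨B, hB⟩ := (Set.finite_range f).bddAbove
  refine ⟨max m B, le_max_left _ _, fun l hl hlN => hf ⟨l, hl⟩ ?_⟩
  exact multiples_antitone ((hB ⟨⟨l, hl⟩, rfl⟩).trans (le_max_right m B)) hlN

/-- A countable torsion group with an infinite primary component for an odd prime has a nilpotent
summand. -/
theorem nonempty_nilpotentSummand_of_infinite [Countable Y] {p : ℕ} (hp : p.Prime) (hp2 : p ≠ 2)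
    (hY : ∀ y : Y, ∃ m : ℕ, 0 < m ∧ m • y = 0) (hinf : {y : Y | ∃ k : ℕ, p ^ k • y = 0}.Infinite) :
    Nonempty (NilpotentSummand Y) := by
  by_contra hcon
  -- The construction of a cyclic system must get stuck for every set of exponents. `Set.univ`
  -- controls all large exponents at once; singletons control each exponent separately.
  have hM : ∀ M : Set ℕ, M.Nonempty → ∃ m ∈ M, ∃ L : AddSubgroup Y, Finite L ∧ ∀ n ∈ M, m ≤ n →
      ∀ z : Y, p ^ (n + 1) • z = 0 → p ^ n • z ∈ L ⊔ multiples Y (p ^ (n + 1)) := by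
    intro M hM
    by_contra! h
    obtain ⟨C⟩ := nonempty_cyclicSystem hp hY hM h
    exact hcon ⟨C.nilpotentSummand hp hp2⟩
  obtain ⟨m, -, L, hL, hLz⟩ := hM Set.univ Set.univ_nonempty
  -- From `N` on, the correction from `L` has infinite height and is absorbed into `multiples Y (p ^
  -- (n + 1))`.
  obtain ⟨N, hmN, hN⟩ := exists_height_bound (p := p) L m
  have hdiv : ∀ n, N ≤ n → ∀ z : Y, p ^ (n + 1) • z = 0 →
      p ^ n • z ∈ multiples Y (p ^ (n + 1)) := by
    intro n hn z hz
    obtain ⟨l, hl, q, hq, hlq⟩ := AddSubgroup.mem_sup.mp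
      (hLz n (Set.mem_univ n) (hmN.trans hn) z hz)
    have hln : l ∈ multiples Y (p ^ n) := by
      rw [eq_sub_of_add_eq hlq]
      exact sub_mem (nsmul_mem_multiples _ z) (multiples_antitone (Nat.le_succ n) hq)
    rw [← hlq]
    exact add_mem (hN l hl (multiples_antitone hn hln) _) hq
  have hbot : primaryMultiples Y p N = ⊥ := by
    by_contra hne
    exact hcon (nonempty_nilpotentSummand_of_divisible hp (primaryMultiples Y p N)
      (fun d hd => hd.1) (fun d hd => primaryMultiples_divisible hdiv hd) hne)
  have hlayer : {y : Y | p • y = 0 ∧ y ∈ multiples Y (p ^ N)}.Finite := by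
    refine (Set.finite_singleton (0 : Y)).subset ?_
    rintro y ⟨hy, hyN⟩
    have : y ∈ primaryMultiples Y p N := ⟨⟨1, by rwa [pow_one]⟩, hyN⟩
    rw [hbot] at this
    exact this
  have hfin := finite_torsion_of_finite_layers hlayer fun n => by
    obtain ⟨m', hm', L', hL', h'⟩ := hM {n} (Set.singleton_nonempty n)
    rw [Set.mem_singleton_iff] at hm'
    exact ⟨L', hL', h' n rfl hm'.le⟩
  refine hinf ((finite_pow_torsion hfin N).subset ?_)
  rintro y ⟨k, hk⟩
  have : p ^ N • y ∈ primaryMultiples Y p N := by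
    refine ⟨⟨k, ?_⟩, nsmul_mem_multiples _ y⟩
    rw [smul_comm, hk, smul_zero]
  rw [hbot] at this
  exact this

end Dichotomy

/-! ### Profinite groups whose character group has finite primary components -/

/-- The `p`-primary component of the character group. -/
noncomputable abbrev primaryChar (X : Type u) [AddCommGroup X] [TopologicalSpace X] (p : ℕ) :
    AddSubgroup (contChar X) :=
  primaryMultiples (contChar X) p 0

lemma mem_primaryChar {X : Type u} [AddCommGroup X] [TopologicalSpace X] {p : ℕ}
    {y : contChar X} : y ∈ primaryChar X p ↔ ∃ k : ℕ, p ^ k • y = 0 :=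
  ⟨fun h => h.1, fun h => ⟨h, y, by simp⟩⟩

lemma exists_pow_nsmul_primaryChar {X : Type u} [AddCommGroup X] [TopologicalSpace X] (p : ℕ)
    [Finite (primaryChar X p)] : ∃ k : ℕ, ∀ y ∈ primaryChar X p, p ^ k • y = 0 := by
  have key : ∀ y : primaryChar X p, ∃ k : ℕ, p ^ k • y.1 = 0 := fun y => mem_primaryChar.mp y.2
  choose f hf using key
  obtain ⟨B, hB⟩ := (Set.finite_range f).bddAbove
  refine ⟨B, fun y hy => ?_⟩
  obtain ⟨r, hr⟩ := Nat.exists_eq_add_of_le (hB ⟨⟨y, hy⟩, rfl⟩)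
  rw [hr, pow_add, mul_comm, mul_smul, hf ⟨y, hy⟩, smul_zero]

/-- The Chinese remainder theorem for evaluations of primary characters. -/
lemma exists_eval_of_finset {X : Type u} [AddCommGroup X] [TopologicalSpace X]
    (P : Type*) (q : P → ℕ) (hq : ∀ p, (q p).Prime)
    (hinj : Function.Injective q) (hfin : ∀ p, Finite (primaryChar X (q p)))
    (ψ : ∀ p, AddChar (primaryChar X (q p)) Circle) (I : Finset P) :
    ∃ x : X, ∀ p ∈ I, ∀ y : primaryChar X (q p), y.1 x = ψ p y := by
  classical
  have hk := fun p => exists_pow_nsmul_primaryChar (X := X) (q p)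
  choose k hk using hk
  have hpow : ∀ p (y : primaryChar X (q p)) (x : X), (y.1 x) ^ (q p ^ k p) = 1 := by
    intro p y x
    rw [← contChar.nsmul_apply, hk p y.1 y.2, contChar.zero_apply]
  induction I using Finset.induction_on with
  | empty => exact ⟨0, fun p hp => absurd hp (Finset.notMem_empty p)⟩
  | insert p I hpI ih =>
    obtain ⟨x₁, hx₁⟩ := ih
    obtain ⟨x₂, hx₂⟩ := contChar.exists_eval_of_finite _ (ψ p)
    have hcop : Nat.Coprime (q p ^ k p) (∏ r ∈ I, q r ^ k r) := by
      refine Nat.Coprime.prod_right fun r hr => Nat.Coprime.pow _ _ ?_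
      exact (Nat.coprime_primes (hq p) (hq r)).mpr fun h => hpI (hinj h ▸ hr)
    obtain ⟨a, ha0, ha1⟩ := Nat.chineseRemainder hcop 0 1
    obtain ⟨b, hb1, hb0⟩ := Nat.chineseRemainder hcop 1 0
    refine ⟨a • x₁ + b • x₂, fun r hr y => ?_⟩
    rw [contChar.map_add, contChar.map_nsmul, contChar.map_nsmul]
    rcases Finset.mem_insert.mp hr with rfl | hrI
    · rw [pow_eq_pow_of_modEq ha0 (hpow r y x₁), pow_eq_pow_of_modEq hb1 (hpow r y x₂), pow_zero,
        one_mul, pow_one, hx₂]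
    · have hdvd : q r ^ k r ∣ ∏ r ∈ I, q r ^ k r :=
        Finset.dvd_prod_of_mem (fun r => q r ^ k r) hrI
      rw [pow_eq_pow_of_modEq (ha1.of_dvd hdvd) (hpow r y x₁),
        pow_eq_pow_of_modEq (hb0.of_dvd hdvd) (hpow r y x₂), pow_zero, mul_one, pow_one,
        hx₁ r hrI]

section Structure

variable {X : Type u} [AddCommGroup X] [TopologicalSpace X] [IsTopologicalAddGroup X]
  [CompactSpace X] [TotallyDisconnectedSpace X]

/-- If `X` has no elements of order two, its character group is divisible by two. -/
lemma exists_add_self_eq (hX : ∀ x : X, addOrderOf x ≠ 2) (y : contChar X) :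
    ∃ z : contChar X, z + z = y := by
  by_contra! hcon
  -- A character that is not a double is detected by a homomorphism to `ZMod 2`, which by duality is
  -- evaluation at a point of order two.
  have hy : 2 ^ 0 • y ∉ (⊥ : AddSubgroup (contChar X)) ⊔ multiples (contChar X) (2 ^ (0 + 1)) := by
    rw [bot_sup_eq, pow_zero, one_smul]
    rintro ⟨z, hz⟩
    exact hcon z (by rw [← hz]; simp [two_smul])
  obtain ⟨φ, -, hφ⟩ := exists_hom_zmod Nat.prime_two 0 ⊥ y hy
  obtain ⟨x, hx⟩ := contChar.exists_eval
    ((ZMod.toCircle (N := 2 ^ (0 + 1))).compAddMonoidHom φ)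
  refine hX x (addOrderOf_eq_prime ?_ ?_)
  · refine contChar.eq_of_forall_apply_eq fun z => ?_
    rw [contChar.map_nsmul, ← hx, contChar.map_zero, AddChar.compAddMonoidHom_apply,
      ← AddChar.map_nsmul_eq_pow]
    have : 2 • φ z = 0 := by
      have := ZMod.natCast_self (2 ^ (0 + 1))
      rw [nsmul_eq_mul]
      simp only [zero_add, pow_one] at this
      erw [this]
      exact zero_mul _
    rw [this, AddChar.map_zero_eq_one]
  · intro h0
    have h1 := hx y
    rw [h0, contChar.map_zero, AddChar.compAddMonoidHom_apply, hφ] at h1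
    have h2 := ZMod.injective_toCircle (N := 2 ^ (0 + 1))
      (h1.trans (AddChar.map_zero_eq_one _).symm)
    revert h2
    decide

lemma isOpen_setOf_char_eq (y : contChar X) (c : Circle) : IsOpen {x : X | y x = c} := by
  obtain ⟨V, hV⟩ := contChar.exists_openAddSubgroup_trivial_on y
  rw [isOpen_iff_mem_nhds]
  intro x hx
  have hnhds : {z : X | z - x ∈ (V : Set X)} ∈ nhds x :=
    (V.isOpen.preimage (continuous_id.sub continuous_const)).mem_nhds (by
      change x - x ∈ (V : Set X)
      rw [sub_self]
      exact V.zero_mem)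
  refine Filter.mem_of_superset hnhds fun z hz => ?_
  have := hV _ hz
  rw [contChar.map_sub, div_eq_one] at this
  exact this.trans hx

/-- A profinite group is a product of finite groups of odd prime power orders if the primary
components of its character group are finite, and the one for the prime two is trivial. -/
theorem isProductOfFiniteOddPGroups_of_finite [T2Space X]
    (hfin : ∀ p : {p : ℕ // p.Prime ∧ 2 < p}, Finite (primaryChar X p))
    (h2 : primaryChar X 2 = ⊥) : IsProductOfFiniteOddPGroups X := by
  classical
  let B : {p : ℕ // p.Prime ∧ 2 < p} → Type u := fun p => AddChar (primaryChar X p) Circle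
  have hB : ∀ p, Finite (B p) := fun p => inferInstanceAs (Finite (AddChar _ Circle))
  let ev : ∀ p, X →+ B p := fun p =>
    { toFun := fun x =>
        { toFun := fun y => y.1 x
          map_zero_eq_one' := rfl
          map_add_eq_mul' := fun _ _ => rfl }
      map_zero' := DFunLike.ext _ _ fun y => contChar.map_zero y.1
      map_add' := fun a b => DFunLike.ext _ _ fun y => contChar.map_add y.1 a b }
  -- The duals `B p` live in `Type u`; being finite, they can be moved to `Type`.
  let A : {p : ℕ // p.Prime ∧ 2 < p} → Type := fun p => Shrink.{0} (B p)
  let grp : ∀ p, AddCommGroup (A p) := fun p => inferInstanceAs (AddCommGroup (Shrink.{0} (B p)))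
  let top : ∀ p, TopologicalSpace (A p) := fun p => ⊥
  have hdisc : ∀ p, DiscreteTopology (A p) := fun p => ⟨rfl⟩
  let e : ∀ p, B p ≃+ A p := fun p => Shrink.addEquiv.symm
  let Φ : X →+ (∀ p, A p) := AddMonoidHom.pi fun p => (e p).toAddMonoidHom.comp (ev p)
  have hΦ : ∀ x p, Φ x p = e p (ev p x) := fun _ _ => rfl
  have hcont : Continuous Φ := by
    refine continuous_pi fun p => ?_
    rw [continuous_discrete_rng]
    intro a
    have : (fun x => Φ x p) ⁻¹' {a} =
        ⋂ y : primaryChar X p, {x | y.1 x = ((e p).symm a : AddChar _ Circle) y} := by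
      ext x
      rw [Set.mem_preimage, Set.mem_singleton_iff, Set.mem_iInter, hΦ,
        ← (e p).eq_symm_apply, DFunLike.ext_iff]
      rfl
    rw [this]
    exact isOpen_iInter_of_finite fun y => isOpen_setOf_char_eq y.1 _
  have hinj : Function.Injective Φ := by
    rw [injective_iff_map_eq_zero]
    intro x hx
    have hprim : ∀ p : ℕ, p.Prime → ∀ y ∈ primaryChar X p, y x = 1 := by
      intro p hp y hy
      rcases hp.two_le.eq_or_lt with rfl | hlt
      · rw [h2] at hy
        rw [(AddSubgroup.mem_bot).mp hy, contChar.zero_apply]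
      · have h1 := congrFun hx ⟨p, hp, hlt⟩
        rw [hΦ, Pi.zero_apply, map_eq_zero_iff _ (e _).injective] at h1
        exact DFunLike.congr_fun h1 ⟨y, hy⟩
    refine contChar.eq_of_forall_apply_eq fun y => ?_
    rw [contChar.map_zero]
    have key : ∀ m : ℕ, m ≠ 0 → ∀ y : contChar X, m • y = 0 → y x = 1 := by
      intro m
      induction m using Nat.recOnPrimeCoprime with
      | zero => exact fun h => absurd rfl h
      | prime_pow p n hp => exact fun _ y hy => hprim p hp y (mem_primaryChar.mpr ⟨n, hy⟩)
      | coprime a b ha hb hab iha ihb =>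
        intro _ y hy
        have h1 : (y x) ^ b = 1 := iha (by omega) (b • y) (by rw [← mul_smul]; exact hy)
        have h2 : (y x) ^ a = 1 := ihb (by omega) (a • y) (by rw [← mul_smul, mul_comm]; exact hy)
        have := pow_gcd_eq_one.mpr ⟨h2, h1⟩
        rwa [hab, pow_one] at this
    obtain ⟨m, hm, hmy⟩ := contChar.exists_nsmul_eq_zero y
    exact key m hm.ne' y hmy
  have hsurj : Function.Surjective Φ := by
    intro a
    -- Compactness reduces to finitely many primes, where the Chinese remainder theorem supplies a
    -- common point.
    have hne : (⋂ p : {p : ℕ // p.Prime ∧ 2 < p}, {x : X | ∀ y : primaryChar X p,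
        y.1 x = ((e p).symm (a p) : AddChar _ Circle) y}).Nonempty := by
      apply CompactSpace.iInter_nonempty
      · intro p
        have : {x : X | ∀ y : primaryChar X p,
            y.1 x = ((e p).symm (a p) : AddChar _ Circle) y} = ⋂ y : primaryChar X p,
            {x : X | y.1 x = ((e p).symm (a p) : AddChar _ Circle) y} := by
          ext x
          rw [Set.mem_iInter]
          rfl
        rw [this]
        exact isClosed_iInter fun y =>
          isClosed_eq (contChar.continuous_coe y.1) continuous_const
      · intro I
        obtain ⟨x, hx⟩ := exists_eval_of_finset (X := X) {p : ℕ // p.Prime ∧ 2 < p}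
          Subtype.val (fun p => p.2.1) Subtype.val_injective hfin
          (fun p => (e p).symm (a p)) I
        exact ⟨x, Set.mem_iInter₂.mpr hx⟩
    obtain ⟨x, hx⟩ := hne
    refine ⟨x, funext fun p => ?_⟩
    rw [hΦ, ← (e p).eq_symm_apply]
    exact DFunLike.ext _ _ (Set.mem_iInter.mp hx p)
  refine ⟨A, grp, top, hdisc, fun p => Finite.of_equiv _ (e p).toEquiv,
    fun p x => ?_, ?_⟩
  · obtain ⟨k, hk⟩ := exists_pow_nsmul_primaryChar (X := X) p
    have hx : (p : ℕ) ^ k • x = 0 := by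
      apply (e p).symm.injective
      rw [map_nsmul, map_zero]
      refine DFunLike.ext _ _ fun y => ?_
      change ((e p).symm x : AddChar _ Circle) y ^ (p : ℕ) ^ k = 1
      rw [← AddChar.map_nsmul_eq_pow, show (p : ℕ) ^ k • y = 0 from Subtype.ext (hk y.1 y.2),
        AddChar.map_zero_eq_one]
    obtain ⟨j, -, hj⟩ := (Nat.dvd_prime_pow p.2.1).mp (addOrderOf_dvd_of_nsmul_eq_zero hx)
    exact ⟨j, hj⟩
  · let E : X ≃+ (∀ p, A p) := AddEquiv.ofBijective Φ ⟨hinj, hsurj⟩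
    have hE : Continuous E.toEquiv := hcont
    exact ⟨{ E with
      continuous_toFun := hcont
      continuous_invFun := hE.continuous_symm_of_equiv_compact_to_t2 }⟩

end Structure

theorem theorem2p1 (X : Type u) [AddCommGroup X] [TopologicalSpace X]
    [IsTopologicalAddGroup X] [CompactSpace X] [T2Space X] [SecondCountableTopology X]
    [TotallyDisconnectedSpace X] [MeasurableSpace X] [BorelSpace X]
    (hX : ∀ x : X, addOrderOf x ≠ 2) :
    ((∀ α : X ≃ₜ+ X, KerOneAddTrivial α →
        ∀ (Ω : Type v) [MeasurableSpace Ω] (P : Measure Ω) [IsProbabilityMeasure P]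
          (ξ₁ ξ₂ : Ω → X), Measurable ξ₁ → Measurable ξ₂ → IndepFun ξ₁ ξ₂ P →
          CondDistribSymmetric (fun ω => ξ₁ ω + α (ξ₂ ω)) (fun ω => ξ₁ ω + ξ₂ ω) P →
          P.map ξ₁ ∈ haarShifts X ∧ P.map ξ₂ ∈ haarShifts X) ↔
      IsProductOfFiniteOddPGroups X) ∧
    (IsProductOfFiniteOddPGroups X →
      ∀ α : X ≃ₜ+ X, KerOneAddTrivial α →
        ∀ (Ω : Type v) [MeasurableSpace Ω] (P : Measure Ω) [IsProbabilityMeasure P]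
          (ξ₁ ξ₂ : Ω → X), Measurable ξ₁ → Measurable ξ₂ → IndepFun ξ₁ ξ₂ P →
          CondDistribSymmetric (fun ω => ξ₁ ω + α (ξ₂ ω)) (fun ω => ξ₁ ω + ξ₂ ω) P →
          ∃ (K : AddSubgroup X) (_ : CompactSpace K),
            IsShiftOfHaar K (P.map ξ₁) ∧ IsShiftOfHaar K (P.map ξ₂) ∧
            K.map α.toAddEquiv.toAddMonoidHom = K) := by
  have strong : IsProductOfFiniteOddPGroups X →
      ∀ α : X ≃ₜ+ X, KerOneAddTrivial α →
        ∀ (Ω : Type v) [MeasurableSpace Ω] (P : Measure Ω) [IsProbabilityMeasure P]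
          (ξ₁ ξ₂ : Ω → X), Measurable ξ₁ → Measurable ξ₂ → IndepFun ξ₁ ξ₂ P →
          CondDistribSymmetric (fun ω => ξ₁ ω + α (ξ₂ ω)) (fun ω => ξ₁ ω + ξ₂ ω) P →
          ∃ (K : AddSubgroup X) (_ : CompactSpace K),
            IsShiftOfHaar K (P.map ξ₁) ∧ IsShiftOfHaar K (P.map ξ₂) ∧
            K.map α.toAddEquiv.toAddMonoidHom = K :=
    fun hprod α hα Ω _ P _ ξ₁ ξ₂ h₁ h₂ hind hs =>
      exists_common_haar_shift hX hprod.isFinitePrimary α hα P ξ₁ ξ₂ h₁ h₂ hind hs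
  refine ⟨⟨fun ha => ?_, fun hprod α hα Ω _ P _ ξ₁ ξ₂ h₁ h₂ hind hs => ?_⟩, strong⟩
  · have h2 := exists_add_self_eq hX
    have hno : ¬ Nonempty (NilpotentSummand (contChar X)) := by
      rintro ⟨N⟩
      obtain ⟨α, hα, μ, hμ, hμX, heq⟩ := N.exists_counterexample h2
      obtain ⟨Ω, _, P, _, ξ₁, ξ₂, h₁, h₂, hind, e₁, e₂⟩ := exists_indepFun_map_eq.{u, v} μ
      refine hμX (e₁ ▸ (ha α hα Ω P ξ₁ ξ₂ h₁ h₂ hind ?_).1)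
      refine (condDistribSymmetric_iff_fourierTransform h₁ h₂ hind
        α.toAddEquiv.toAddMonoidHom α.continuous).mpr ?_
      rw [e₁, e₂]
      exact heq
    refine isProductOfFiniteOddPGroups_of_finite (fun p => ?_) ?_
    · by_contra hinf
      refine hno (nonempty_nilpotentSummand_of_infinite p.2.1 p.2.2.ne'
        contChar.exists_nsmul_eq_zero fun hfin => hinf ?_)
      exact (hfin.subset fun y hy => mem_primaryChar.mp hy).to_subtype
    · by_contra hne
      -- Every character is a double, so the 2-primary component is divisible and must vanish.
      refine hno (nonempty_nilpotentSummand_of_divisible Nat.prime_two (primaryChar X 2)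
        (fun d hd => mem_primaryChar.mp hd) (fun d hd => ?_) hne)
      obtain ⟨k, hk⟩ := mem_primaryChar.mp hd
      obtain ⟨z, rfl⟩ := h2 d
      refine ⟨z, mem_primaryChar.mpr ⟨k + 1, ?_⟩, two_smul ℕ z⟩
      rw [pow_succ, mul_smul, two_smul ℕ z, hk]
  · obtain ⟨K, hK, s₁, s₂, -⟩ := strong hprod α hα Ω P ξ₁ ξ₂ h₁ h₂ hind hs
    exact ⟨⟨K, hK, s₁⟩, ⟨K, hK, s₂⟩⟩
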